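/- Consider the cell-probe model with word size $w=1$ (the bit-probe model): the memory is an unbounded array of one-bit cells, the computing unit has no memory of its own, computation is free and may be non-uniform, and the time spent on an arriving symbol is the number of distinct cells accessed. Let $q\ge 4$ be the alphabet size, let $F\in[q]^n$ be a fixed string, where $[q]=\{0,\dots,q-1\}$, and let $S\in[q]^{3n}$ be a stream whose symbols arrive one at a time. After each of the arrivals $S[2n+t]$, $0\le t<n$, and before the next symbol arrives, an algorithm has to output $Y[t]$, where in the edit distance problem $$Y[t]=\min_{0\le i\le 2n+t}\mathrm{Edit}\big(F,\;S[i]\cdots S[2n+t]\big)$$ (the minimal number of single-symbol replacements, deletions and insertions, minimised over the suffixes of the stream), and in the LCS problem $$Y[t]=\mathrm{LCS}\big(F,\;S[n+t+1]\cdots S[2n+t]\big)$$ (the length of a longest common subsequence of $F$ and the latest $n$ symbols). For either problem, every randomised algorithm that solves it (with correct outputs with probability one on every input) has, on a worst-case input, expected amortised time per output $$\Omega\!\left(\frac{\sqrt{\log_2 n}}{(\log_2\log_2 n)^{3/2}}\right)\qquad(n\to\infty),$$ where the amortised time is the total time over the $n$ arrivals $S[2n],\dots,S[3n-1]$ divided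 by $n$, and the constant is absolute. More precisely, for all large $n$, all $q\ge4$ and either problem there is a string $F\in[q]^n$ such that for every randomised algorithm that solves the problem for this $F$ (possibly knowing $F$ in advance) there is a stream $S$ on which this bound holds. The bound also holds when the outputs are succinctly encoded: it suffices that the algorithm outputs after each arrival some code from which the required value can be recovered given the required value one symbol earlier (for instance the difference of these two values, which is always $-1$, $0$ or $1$). -/

import Mathlib

open MeasureTheory
open scoped ENNReal

/-! ### Edit distance and longest common subsequences of strings -/

/-- One single-symbol edit operation (replace, delete or insert), at any position. -/
inductive EditStep {α : Type*} : List α → List α → Prop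
  | replace (u v : List α) (a b : α) : EditStep (u ++ a :: v) (u ++ b :: v)
  | delete (u v : List α) (a : α) : EditStep (u ++ a :: v) (u ++ v)
  | insert (u v : List α) (a : α) : EditStep (u ++ v) (u ++ a :: v)

/-- `EditSeq k A B`: the string `A` can be transformed into `B` by `k` edit operations. -/
inductive EditSeq {α : Type*} : ℕ → List α → List α → Prop
  | refl (A : List α) : EditSeq 0 A A
  | tail {k : ℕ} {A B C : List α} (h : EditSeq k A B) (s : EditStep B C) : EditSeq (k + 1) A C

/-- The edit distance: the minimal number of edit operations that transform `A` into `B`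
(any string can be transformed into any other, so the minimum is over a nonempty set). -/
noncomputable def editDist {α : Type*} (A B : List α) : ℕ :=
  sInf {k | EditSeq k A B}

/-- The length of a longest common subsequence of `A` and `B`
(a supremum over a nonempty set that is bounded by the length of `A`). -/
noncomputable def lcsLength {α : Type*} (A B : List α) : ℕ :=
  sSup {k | ∃ C : List α, C.Sublist A ∧ C.Sublist B ∧ C.length = k}

/-! ### The streaming problems -/

/-- The substring `S[i], S[i+1], …, S[j-1]` of the stream `S`. -/
def substream {α : Type*} (S : ℕ → α) (i j : ℕ) : List α :=
  (List.Ico i j).map S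

/-- The two streaming problems. -/
inductive StreamProblem
  | editDistance
  | lcs

/-- The value that is asked for when the symbols that have arrived are `S[0], …, S[m-1]`
(used for `1 ≤ n` and `2 * n ≤ m` only): for edit distance the minimum over all suffixes of the
stream, for LCS the value against the window of the latest `n` symbols. -/
noncomputable def StreamProblem.value {n q : ℕ} (P : StreamProblem) (F : Fin n → Fin q)
    (S : ℕ → Fin q) (m : ℕ) : ℕ :=
  match P with
  | .editDistance => sInf {d | ∃ i < m, d = editDist (List.ofFn F) (substream S i m)}
  | .lcs => lcsLength (List.ofFn F) (substream S (m - n) m)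

/-! ### The cell-probe model -/

/-- The memory: an unbounded array of cells of `w` bits each. -/
abbrev Memory (w : ℕ) : Type := ℕ → BitVec w

/-- What the computing unit does on one arrival: it adaptively reads and writes cells and finally
returns an output in `O`. Only the cells it accesses are charged; the computation in between is
free and non-uniform, hence an arbitrary decision tree. -/
inductive Program (w : ℕ) (O : Type*)
  | output (o : O) : Program w O
  | read (a : ℕ) (next : BitVec w → Program w O) : Program w O
  | write (a : ℕ) (x : BitVec w) (next : Program w O) : Program w O

namespace Program

variable {w : ℕ} {O : Type*}

/-- The output of a program started on memory `M`. -/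
def result : Program w O → Memory w → O
  | output o, _ => o
  | read a next, M => result (next (M a)) M
  | write a x next, M => result next (Function.update M a x)

/-- The memory that a program started on memory `M` leaves behind. -/
def finalMemory : Program w O → Memory w → Memory w
  | output _, M => M
  | read a next, M => finalMemory (next (M a)) M
  | write a x next, M => finalMemory next (Function.update M a x)

/-- The set of cells that a program started on memory `M` accesses. -/
def accessed : Program w O → Memory w → Finset ℕ
  | output _, _ => ∅
  | read a next, M => insert a (accessed (next (M a)) M)
  | write a x next, M => insert a (accessed next (Function.update M a x))

end Program

/-- A deterministic online cell-probe algorithm with word size `w` for streams over the alphabet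
`Fin q`: the initial contents of the memory, and for each `k` and each symbol `x` the program that
is run when `x` arrives as the symbol `S[k]`. Nothing but the memory survives from one arrival to
the next (a program may depend on the position `k`). -/
structure CellProbeAlgorithm (w q : ℕ) (O : Type*) where
  /-- the initial contents of the memory -/
  init : Memory w
  /-- the program that is run when a symbol arrives at a given position of the stream -/
  step : ℕ → Fin q → Program w O

namespace CellProbeAlgorithm

variable {w q : ℕ} {O : Type*}

/-- The memory after the first `k` symbols `S[0], …, S[k-1]` have been handled. -/
def memoryAfter (A : CellProbeAlgorithm w q O) (S : ℕ → Fin q) : ℕ → Memory w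
  | 0 => A.init
  | k + 1 => (A.step k (S k)).finalMemory (memoryAfter A S k)

/-- What the algorithm outputs upon the arrival of `S[k]`. -/
def outputAt (A : CellProbeAlgorithm w q O) (S : ℕ → Fin q) (k : ℕ) : O :=
  (A.step k (S k)).result (A.memoryAfter S k)

/-- The time spent on the arrival of `S[k]`: the number of distinct cells accessed. -/
def timeAt (A : CellProbeAlgorithm w q O) (S : ℕ → Fin q) (k : ℕ) : ℕ :=
  ((A.step k (S k)).accessed (A.memoryAfter S k)).card

/-- The total time over the `n` arrivals `S[2n], …, S[3n-1]`, for which outputs are required. -/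
def totalTime (A : CellProbeAlgorithm w q O) (n : ℕ) (S : ℕ → Fin q) : ℕ :=
  ∑ t ∈ Finset.range n, A.timeAt S (2 * n + t)

/-- `A` answers correctly on the stream `S` with fixed string `F`, where the outputs are encoded
according to `dec`: for each of the arrivals `S[2n], …, S[3n-1]`, the value `Y` that is asked for
is `dec Y' o`, where `Y'` is the value one symbol earlier and `o` is what `A` outputs.
If `dec = fun _ o => o`, the values themselves are output. If `dec` adds to `Y'` a difference
given by `o : Fin 3`, the outputs are succinctly encoded, in a constant number of bits. -/
def CorrectOn {n : ℕ} (A : CellProbeAlgorithm w q O) (P : StreamProblem) (dec : ℕ → O → ℕ)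
    (F : Fin n → Fin q) (S : ℕ → Fin q) : Prop :=
  ∀ t < n, dec (P.value F S (2 * n + t)) (A.outputAt S (2 * n + t)) =
    P.value F S (2 * n + t + 1)

end CellProbeAlgorithm

/-- A randomised algorithm is a random choice of a deterministic one: a family `A ω` for a random
`ω` (whose time on any given stream is a random variable). It solves the problem `P` for the
fixed string `F`, with outputs encoded according to `dec`, if on every stream it answers correctly
with probability one. -/
structure Solves {w q n : ℕ} {O Ω : Type*} [MeasurableSpace Ω] (μ : Measure Ω)
    (A : Ω → CellProbeAlgorithm w q O) (P : StreamProblem) (dec : ℕ → O → ℕ)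
    (F : Fin n → Fin q) : Prop where
  aemeasurable_time : ∀ S : ℕ → Fin q, AEMeasurable (fun ω => (A ω).totalTime n S) μ
  correct : ∀ S : ℕ → Fin q, ∀ᵐ ω ∂μ, (A ω).CorrectOn P dec F S

/-- The expected amortised time per output of a randomised algorithm on the stream `S`: the
expected total time over the `n` arrivals `S[2n], …, S[3n-1]`, divided by `n`. -/
noncomputable def expectedAmortisedTime {w q : ℕ} {O Ω : Type*} [MeasurableSpace Ω]
    (μ : Measure Ω) (A : Ω → CellProbeAlgorithm w q O) (n : ℕ) (S : ℕ → Fin q) : ℝ≥0∞ :=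
  (∫⁻ ω, ((A ω).totalTime n S : ℝ≥0∞) ∂μ) / n

/-! The proof is an information-transfer argument on dyadic intervals, adapted to one-bit cells.

Pattern and stream are made of blocks of length `r = 4 * E + 1`, one data symbol and `4 * E`
fillers. In the pattern the data symbol is matchable only in `K` special blocks, at distances `2 ^
K, …, 2 ^ (2 * K - 1)` from the end; the data of the stream are random bits. An alignment whose
block shift has total variation `V` leaves at least `4 * E * V` fillers unmatched in the two strings
together, which costs `2 * E * V` matches, whereas on balanced data it gains at most that many data
matches. So the unshifted alignment is optimal (`length_add_le_of_sublist`), and the value at the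
end of block `β` reveals how many of the bits `x (β - 2 ^ (K + s))` are zero
(`value_hardPattern_hardStream`). By a Chernoff bound, `E` of order `√(K log K)` makes unbalanced
data rare.

Take a dyadic interval with halves of `2 ^ i` blocks, `K ≤ i < 2 * K`. The outputs during the second
half, the value at the midpoint and the bits that belong to unbalanced blocks determine all `2 ^ i`
bits of the first half (`eq_of_outputs_eq`). The outputs depend on these bits only through cells
accessed in both halves. Listing the addresses of such cells would be too expensive for one-bit
cells; instead `exists_weight` marks every access as transferred or not, at a cost of `log (1 / z)`
per transferred cell and at most `2 * z` per accessed cell. Kraft's inequality then bounds the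
average cost from below by about `2 ^ i * log 2` (`information_transfer`).

Over all levels the transferred cells number at most the total time `T`
(`sum_card_inter_dyadic_le`). With `z = 1 / K`, summing over the `K` levels gives that the average
of `T * (log K + 2)` is at least a constant times `K * n / r` (`sum_totalTime_ge`). As `K` is about
a quarter of `log₂ n` and `r` is of order `√(K log K)`, this is the claimed rate. Averaging over the
hard streams covers randomised algorithms. -/

/-! ### A Kraft inequality for bit-probe programs -/

namespace Program

variable {w : ℕ} {O O' : Type*}

/-- Sequential composition of programs. -/
def bind : Program w O → (O → Program w O') → Program w O'
  | output o, f => f o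
  | read a next, f => read a fun v => bind (next v) f
  | write a x next, f => write a x (bind next f)

theorem result_bind (p : Program w O) (f : O → Program w O') (M : Memory w) :
    (p.bind f).result M = (f (p.result M)).result (p.finalMemory M) := by
  induction p generalizing M with
  | output o => rfl
  | read a next ih => exact ih _ _
  | write a x next ih => exact ih _

theorem accessed_bind (p : Program w O) (f : O → Program w O') (M : Memory w) :
    (p.bind f).accessed M =
      p.accessed M ∪ (f (p.result M)).accessed (p.finalMemory M) := by
  induction p generalizing M with
  | output o => simp [bind, accessed, result, finalMemory]
  | read a next ih => simp [bind, accessed, result, finalMemory, ih]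
  | write a x next ih => simp [bind, accessed, result, finalMemory, ih]

theorem finalMemory_of_notMem_accessed (p : Program w O) (M : Memory w) (a : ℕ)
    (h : a ∉ p.accessed M) : p.finalMemory M a = M a := by
  induction p generalizing M with
  | output o => rfl
  | read b next ih =>
    simp only [accessed, Finset.mem_insert, not_or] at h
    exact ih _ _ h.2
  | write b x next ih =>
    simp only [accessed, Finset.mem_insert, not_or] at h
    simp only [finalMemory]
    rw [ih _ h.2, Function.update_of_ne h.1]

/-- A Kraft inequality for the results of a bit-probe program on memories that differ from `M₀`
in a set `W` of cells only: some subprobability distribution gives each result a weight of at least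
`z ^ #(accessed cells in W) / (1 + 2 * z) ^ #(accessed cells)`. The cells in `Kn` are known and not
counted. -/
theorem exists_weight (z : ℝ) (hz0 : 0 < z) (hz1 : z ≤ 1) (P : Program 1 O) :
    ∀ (M₀ : Memory 1) (Kn : Finset ℕ), ∃ f : O → ℝ, (∀ o, 0 ≤ f o) ∧
      (∀ s : Finset O, ∑ o ∈ s, f o ≤ 1) ∧
      ∀ (M : Memory 1) (W : Finset ℕ), (∀ a ∉ W, M a = M₀ a) → (∀ a ∈ Kn, a ∉ W) →
        z ^ (P.accessed M ∩ W).card ≤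
          f (P.result M) * (1 + 2 * z) ^ (P.accessed M \ Kn).card := by
  classical
  have hq : 1 ≤ 1 + 2 * z := by linarith
  induction P with
  | output o =>
    intro M₀ Kn
    refine ⟨fun o' => if o' = o then 1 else 0, fun o' => by positivity, fun s => ?_, ?_⟩
    · rw [Finset.sum_ite_eq']; split_ifs <;> norm_num
    · intro M W _ _
      simp [accessed, result]
  | read a next ih =>
    intro M₀ Kn
    by_cases ha : a ∈ Kn
    -- A known cell lies outside `W`, so its content is that of `M₀` and nothing is spent.
    · obtain ⟨f, h0, h1, h2⟩ := ih (M₀ a) M₀ Kn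
      refine ⟨f, h0, h1, fun M W hM hW => ?_⟩
      have haW := hW a ha
      have := h2 M W hM hW
      simp only [accessed, result]
      rw [hM a haW, Finset.insert_inter_of_notMem haW, Finset.insert_sdiff_of_mem _ ha]
      exact this
    -- `f` serves the case `a ∉ W`, and `g v` the case that `a ∈ W` has content `v`. Mixing them
    -- with weights `1, z, z` over `1 + 2 * z` pays for the flag and the bit; afterwards the cell is
    -- known.
    · obtain ⟨f, f0, f1, f2⟩ := ih (M₀ a) M₀ (insert a Kn)
      choose g g0 g1 g2 using fun v : BitVec 1 => ih v (Function.update M₀ a v) (insert a Kn)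
      refine ⟨fun o => (f o + z * (g 0#1 o + g 1#1 o)) / (1 + 2 * z), fun o => ?_, fun s => ?_, ?_⟩
      · have := f0 o; have := g0 0#1 o; have := g0 1#1 o; positivity
      · rw [← Finset.sum_div, div_le_one (by linarith), Finset.sum_add_distrib, ← Finset.mul_sum,
          Finset.sum_add_distrib]
        have h1 := f1 s
        have h2 := g1 0#1 s
        have h3 := g1 1#1 s
        nlinarith
      · intro M W hM hW
        simp only [accessed, result]
        have hT : (insert a ((next (M a)).accessed M) \ Kn).card =
            ((next (M a)).accessed M \ insert a Kn).card + 1 := by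
          have : insert a ((next (M a)).accessed M) \ Kn =
              insert a ((next (M a)).accessed M \ insert a Kn) := by
            ext b; simp only [Finset.mem_sdiff, Finset.mem_insert]
            by_cases hb : b = a
            · subst hb; simp [ha]
            · simp [hb]
          rw [this, Finset.card_insert_of_notMem (by simp)]
        rw [hT, pow_succ, ← mul_assoc, mul_right_comm, div_mul_cancel₀ _ (by linarith)]
        set o := (next (M a)).result M
        have hp : 0 < (1 + 2 * z) ^ ((next (M a)).accessed M \ insert a Kn).card := by positivity
        by_cases haW : a ∈ W
        · have h := g2 (M a) M (W.erase a) (fun b hb => by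
            by_cases hba : b = a
            · subst hba; simp
            · rw [Function.update_of_ne hba]
              exact hM b fun h => hb (Finset.mem_erase.2 ⟨hba, h⟩))
            (fun b hb => by
              rcases Finset.mem_insert.1 hb with rfl | hb
              · simp
              · exact fun h => hW b hb (Finset.mem_of_mem_erase h))
          have hI : (insert a ((next (M a)).accessed M) ∩ W).card =
              ((next (M a)).accessed M ∩ W.erase a).card + 1 := by
            have : insert a ((next (M a)).accessed M) ∩ W =
                insert a ((next (M a)).accessed M ∩ W.erase a) := by
              ext b; simp only [Finset.mem_inter, Finset.mem_insert, Finset.mem_erase]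
              by_cases hb : b = a
              · subst hb; simp [haW]
              · simp [hb]
            rw [this, Finset.card_insert_of_notMem (by simp)]
          rw [hI, pow_succ, mul_comm]
          have hg : g (M a) o ≤ g 0#1 o + g 1#1 o := by
            rcases BitVec.eq_zero_or_eq_one (M a) with h | h <;> rw [h]
            · linarith [g0 1#1 o]
            · linarith [g0 0#1 o]
          calc z * z ^ ((next (M a)).accessed M ∩ W.erase a).card
              ≤ z * (g (M a) o * (1 + 2 * z) ^ ((next (M a)).accessed M \ insert a Kn).card) := by
                gcongr
            _ ≤ (z * (g 0#1 o + g 1#1 o)) *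
                (1 + 2 * z) ^ ((next (M a)).accessed M \ insert a Kn).card := by
                rw [← mul_assoc]; gcongr
            _ ≤ _ := by gcongr; linarith [f0 o]
        · have h := f2 M W hM (fun b hb => by
            rcases Finset.mem_insert.1 hb with rfl | hb
            · exact haW
            · exact hW b hb)
          rw [Finset.insert_inter_of_notMem haW]
          have e : M a = M₀ a := hM a haW
          rw [← e] at h
          refine h.trans ?_
          gcongr
          have := g0 0#1 o; have := g0 1#1 o
          have : 0 ≤ z * (g 0#1 o + g 1#1 o) := by positivity
          linarith
  | write a x next ih =>
    -- The content written does not depend on the memory, so the cell leaves `W` and becomes known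
    -- at no cost.
    intro M₀ Kn
    obtain ⟨f, f0, f1, f2⟩ := ih (Function.update M₀ a x) (insert a Kn)
    refine ⟨f, f0, f1, fun M W hM hW => ?_⟩
    simp only [accessed, result]
    have h := f2 (Function.update M a x) (W.erase a) (fun b hb => by
      by_cases hba : b = a
      · subst hba; simp
      · rw [Function.update_of_ne hba, Function.update_of_ne hba]
        exact hM b fun h => hb (Finset.mem_erase.2 ⟨hba, h⟩))
      (fun b hb => by
        rcases Finset.mem_insert.1 hb with rfl | hb
        · simp
        · exact fun h => hW b hb (Finset.mem_of_mem_erase h))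
    set B := next.accessed (Function.update M a x)
    calc z ^ (insert a B ∩ W).card ≤ z ^ (B ∩ W.erase a).card :=
          pow_le_pow_of_le_one hz0.le hz1 (Finset.card_le_card
            (Finset.inter_subset_inter (Finset.subset_insert _ _) (Finset.erase_subset _ _)))
      _ ≤ _ := h
      _ ≤ _ := by
        apply mul_le_mul_of_nonneg_left _ (f0 _)
        exact pow_le_pow_right₀ hq (Finset.card_le_card
          (Finset.sdiff_subset_sdiff (Finset.subset_insert _ _) (Finset.subset_insert _ _)))

end Program

/-! ### Runs over several arrivals -/

namespace CellProbeAlgorithm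

variable {w q : ℕ} {O : Type*}

/-- The programs for `len` arrivals from the arrival of `S[t]` on, run one after the other. -/
def run (A : CellProbeAlgorithm w q O) (S : ℕ → Fin q) : ℕ → ℕ → Program w (List O)
  | _, 0 => .output []
  | t, len + 1 => (A.step t (S t)).bind fun o =>
      (run A S (t + 1) len).bind fun l => .output (o :: l)

theorem run_result (A : CellProbeAlgorithm w q O) (S : ℕ → Fin q) (t len : ℕ) :
    (A.run S t len).result (A.memoryAfter S t) =
      (List.range len).map fun s => A.outputAt S (t + s) := by
  induction len generalizing t with
  | zero => rfl
  | succ len ih =>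
    rw [run, Program.result_bind, Program.result_bind]
    change A.outputAt S t :: (A.run S (t + 1) len).result (A.memoryAfter S (t + 1)) = _
    rw [ih, List.range_succ_eq_map]
    simp only [List.map_cons, add_zero, List.map_map, Function.comp_def, Nat.succ_eq_add_one]
    simp only [add_assoc, add_comm 1]

theorem run_accessed (A : CellProbeAlgorithm w q O) (S : ℕ → Fin q) (t len : ℕ) :
    (A.run S t len).accessed (A.memoryAfter S t) =
      (Finset.Ico t (t + len)).biUnion
        fun s => (A.step s (S s)).accessed (A.memoryAfter S s) := by
  induction len generalizing t with
  | zero => simp [run, Program.accessed]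
  | succ len ih =>
    rw [run, Program.accessed_bind, Program.accessed_bind]
    change (A.step t (S t)).accessed (A.memoryAfter S t) ∪
      ((A.run S (t + 1) len).accessed (A.memoryAfter S (t + 1)) ∪ ∅) = _
    rw [ih, Finset.union_empty, add_assoc, add_comm 1 len,
      ← Finset.insert_Ico_add_one_left_eq_Ico (show t < t + (len + 1) by omega),
      Finset.biUnion_insert]

theorem run_congr (A : CellProbeAlgorithm w q O) {S S' : ℕ → Fin q} (t len : ℕ)
    (h : ∀ s, t ≤ s → s < t + len → S s = S' s) : A.run S t len = A.run S' t len := by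
  induction len generalizing t with
  | zero => rfl
  | succ len ih =>
    rw [run, run, h t le_rfl (by omega), ih (t + 1) fun s h1 h2 => h s (by omega) (by omega)]

theorem memoryAfter_congr (A : CellProbeAlgorithm w q O) {S S' : ℕ → Fin q} (t : ℕ)
    (h : ∀ s < t, S s = S' s) : A.memoryAfter S t = A.memoryAfter S' t := by
  induction t with
  | zero => rfl
  | succ t ih =>
    rw [memoryAfter, memoryAfter, h t (by omega), ih fun s hs => h s (by omega)]

theorem memoryAfter_add_of_notMem (A : CellProbeAlgorithm w q O) (S : ℕ → Fin q) (t len a : ℕ)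
    (h : a ∉ (Finset.Ico t (t + len)).biUnion
        fun s => (A.step s (S s)).accessed (A.memoryAfter S s)) :
    A.memoryAfter S (t + len) a = A.memoryAfter S t a := by
  induction len with
  | zero => rfl
  | succ len ih =>
    simp only [Finset.mem_biUnion, Finset.mem_Ico, not_exists, not_and] at h ih
    rw [← add_assoc, memoryAfter, Program.finalMemory_of_notMem_accessed _ _ _
      (h _ ⟨by omega, by omega⟩)]
    exact ih fun s hs => h s ⟨hs.1, by omega⟩

end CellProbeAlgorithm

/-! ### Charging transferred cells to accesses -/

/-- The cells that are accessed both in the left and in the right half of a dyadic interval: over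
all dyadic intervals below `R`, their number is at most the total number of accesses. -/
theorem sum_card_inter_dyadic_le (C : ℕ → Finset ℕ) (R : ℕ) (Ls : Finset ℕ) :
    ∑ i ∈ Ls, ∑ k ∈ Finset.range (R / 2 ^ (i + 1)),
      (((Finset.Ico ((2 * k + 1) * 2 ^ i) ((2 * k + 2) * 2 ^ i)).biUnion C) ∩
        ((Finset.Ico (2 * k * 2 ^ i) ((2 * k + 1) * 2 ^ i)).biUnion C)).card ≤
      ∑ β ∈ Finset.range R, (C β).card := by
  classical
  -- A transferred cell is charged to its first access from the midpoint on. The default `0` never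
  -- occurs for the counted pairs.
  set X : (Σ _ : (Σ _ : ℕ, ℕ), ℕ) → ℕ := fun y =>
    if h : ∃ β, (2 * y.1.2 + 1) * 2 ^ y.1.1 ≤ β ∧ y.2 ∈ C β then Nat.find h else 0 with hX
  rw [Finset.sum_sigma', ← Finset.card_sigma, ← Finset.card_sigma]
  have key : ∀ y ∈ (Ls.sigma fun i => Finset.range (R / 2 ^ (i + 1))).sigma (fun y =>
      (((Finset.Ico ((2 * y.2 + 1) * 2 ^ y.1) ((2 * y.2 + 2) * 2 ^ y.1)).biUnion C) ∩
        ((Finset.Ico (2 * y.2 * 2 ^ y.1) ((2 * y.2 + 1) * 2 ^ y.1)).biUnion C))),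
      X y / 2 ^ y.1.1 = 2 * y.1.2 + 1 ∧ X y < R ∧ y.2 ∈ C (X y) ∧
      (∀ β, (2 * y.1.2 + 1) * 2 ^ y.1.1 ≤ β → β < X y → y.2 ∉ C β) ∧
      ∃ β, β / 2 ^ y.1.1 = 2 * y.1.2 ∧ y.2 ∈ C β := by
    rintro ⟨⟨i, k⟩, a⟩ hy
    simp only [Finset.mem_sigma, Finset.mem_range, Finset.mem_inter, Finset.mem_biUnion,
      Finset.mem_Ico] at hy
    obtain ⟨⟨-, hk⟩, ⟨β, ⟨hβ1, hβ2⟩, hβ⟩, ⟨β', ⟨hβ1', hβ2'⟩, hβ'⟩⟩ := hy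
    have h : ∃ β, (2 * k + 1) * 2 ^ i ≤ β ∧ a ∈ C β := ⟨β, hβ1, hβ⟩
    have hx : X ⟨⟨i, k⟩, a⟩ = Nat.find h := by rw [hX]; exact dif_pos h
    have hs := Nat.find_spec h
    have hle : Nat.find h ≤ β := Nat.find_min' h ⟨hβ1, hβ⟩
    have hpos : 0 < 2 ^ i := by positivity
    have hkR : (k + 1) * 2 ^ (i + 1) ≤ R := by
      calc _ ≤ R / 2 ^ (i + 1) * 2 ^ (i + 1) := Nat.mul_le_mul_right _ hk
        _ ≤ R := Nat.div_mul_le_self _ _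
    have e : (k + 1) * 2 ^ (i + 1) = (2 * k + 2) * 2 ^ i := by ring
    refine ⟨?_, ?_, ?_, ?_, β', ?_, hβ'⟩
    · rw [hx, Nat.div_eq_iff hpos]
      have : (2 * k + 2) * 2 ^ i = (2 * k + 1) * 2 ^ i + 2 ^ i := by ring
      dsimp only; omega
    · rw [hx]; omega
    · rw [hx]; exact hs.2
    · intro γ h1 h2 h3
      rw [hx] at h2
      exact Nat.find_min h h2 ⟨h1, h3⟩
    · rw [Nat.div_eq_iff hpos]
      have : (2 * k + 1) * 2 ^ i = 2 * k * 2 ^ i + 2 ^ i := by ring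
      dsimp only; omega
  -- No access is charged at two levels: if `β` lies in the right halves of nested intervals, the
  -- left half of the smaller one is inside the right half of the larger one, so the access `γ`
  -- there precedes `β` and `β` is not the first for the larger interval.
  have aux : ∀ i k i' k' a β, i < i' → β / 2 ^ i = 2 * k + 1 → β / 2 ^ i' = 2 * k' + 1 →
      (∀ γ, (2 * k' + 1) * 2 ^ i' ≤ γ → γ < β → a ∉ C γ) →
      (∃ γ, γ / 2 ^ i = 2 * k ∧ a ∈ C γ) → False := by
    rintro i k i' k' a β hi h1 h2 h3 ⟨γ, hγ, hγa⟩
    obtain ⟨e, rfl⟩ := Nat.exists_eq_add_of_lt hi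
    have hp : (2 : ℕ) ^ (i + e + 1) = 2 ^ i * (2 * 2 ^ e) := by ring
    have hγ2 : γ / 2 ^ (i + e + 1) = 2 * k' + 1 := by
      rw [← h2, hp]
      simp only [← Nat.div_div_eq_div_mul, h1, hγ]
      congr 1; omega
    refine h3 γ ?_ ?_ hγa
    · rw [← hγ2]; exact Nat.div_mul_le_self _ _
    · by_contra hlt
      have := Nat.div_le_div_right (c := 2 ^ i) (not_lt.1 hlt)
      omega
  refine Finset.card_le_card_of_injOn (fun y => ⟨X y, y.2⟩) ?_ ?_
  · intro y hy
    have := key y hy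
    simp only [Finset.coe_sigma, Set.mem_sigma_iff, Finset.coe_range, Set.mem_Iio, Finset.mem_coe]
    exact ⟨this.2.1, this.2.2.1⟩
  · rintro ⟨⟨i, k⟩, a⟩ hy ⟨⟨i', k'⟩, a'⟩ hy' he
    have k1 := key _ hy
    have k2 := key _ hy'
    simp only [Sigma.mk.injEq, heq_eq_eq] at he
    obtain ⟨he, rfl⟩ := he
    rw [← he] at k2
    dsimp only at k1 k2
    rcases lt_trichotomy i i' with h | rfl | h
    · exact (aux _ _ _ _ _ _ h k1.1 k2.1 k2.2.2.2.1 k1.2.2.2.2).elim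
    · obtain rfl : k = k' := by omega
      rfl
    · exact (aux _ _ _ _ _ _ h k2.1 k1.1 k1.2.2.2.1 k2.2.2.2.2).elim

/-! ### Edit sequences and common subsequences -/

section Strings

variable {α : Type*}

theorem EditSeq.trans {k l : ℕ} {A B C : List α} (h : EditSeq k A B) (h' : EditSeq l B C) :
    EditSeq (k + l) A C := by
  induction h' with
  | refl => exact h
  | tail _ s ih => exact (ih h).tail s

theorem EditStep.append_right {A B : List α} (h : EditStep A B) (D : List α) :
    EditStep (A ++ D) (B ++ D) := by
  cases h with
  | replace u v a b => simpa using EditStep.replace u (v ++ D) a b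
  | delete u v a => simpa using EditStep.delete u (v ++ D) a
  | insert u v a => simpa using EditStep.insert u (v ++ D) a

theorem EditSeq.append_right {k : ℕ} {A B : List α} (h : EditSeq k A B) (D : List α) :
    EditSeq k (A ++ D) (B ++ D) := by
  induction h with
  | refl => exact .refl _
  | tail _ s ih => exact ih.tail (s.append_right D)

theorem exists_editSeq (A B : List α) : ∃ k, EditSeq k A B := by
  have h1 : ∀ A : List α, ∃ k, EditSeq k A [] := by
    intro A
    induction A using List.reverseRecOn with
    | nil => exact ⟨0, .refl _⟩
    | append_singleton A a ih =>
      obtain ⟨k, hk⟩ := ih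
      have := (hk.append_right [a]).tail (by simpa using EditStep.delete [] [] a)
      exact ⟨k + 1, this⟩
  have h2 : ∀ B : List α, ∃ k, EditSeq k [] B := by
    intro B
    induction B using List.reverseRecOn with
    | nil => exact ⟨0, .refl _⟩
    | append_singleton B b ih =>
      obtain ⟨k, hk⟩ := ih
      exact ⟨k + 1, hk.tail (by simpa using EditStep.insert B [] b)⟩
  obtain ⟨k, hk⟩ := h1 A
  obtain ⟨l, hl⟩ := h2 B
  exact ⟨k + l, hk.trans hl⟩

theorem editDist_le {k : ℕ} {A B : List α} (h : EditSeq k A B) : editDist A B ≤ k :=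
  Nat.sInf_le h

theorem editSeq_editDist (A B : List α) : EditSeq (editDist A B) A B :=
  Nat.sInf_mem (s := {k | EditSeq k A B}) (exists_editSeq A B)

theorem exists_sublist_of_sublist_append_cons {C u v : List α} {a : α}
    (h : C.Sublist (u ++ a :: v)) :
    ∃ D : List α, D.Sublist C ∧ D.Sublist (u ++ v) ∧ C.length ≤ D.length + 1 := by
  obtain ⟨l₁, l₂, rfl, h1, h2⟩ := List.sublist_append_iff.1 h
  rcases List.sublist_cons_iff.1 h2 with h3 | ⟨l, rfl, h3⟩
  · exact ⟨l₁ ++ l₂, List.Sublist.refl _, h1.append h3, by omega⟩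
  · exact ⟨l₁ ++ l, (List.Sublist.refl _).append (List.sublist_cons_self _ _), h1.append h3,
      by simp; omega⟩

/-- Every edit costs the common subsequence at most one symbol, or lengthens one string by one. This
reduces lower bounds on the edit distance to upper bounds on common subsequences. -/
theorem EditSeq.exists_sublist {k : ℕ} {A B : List α} (h : EditSeq k A B) :
    ∃ C : List α, C.Sublist A ∧ C.Sublist B ∧ A.length ≤ C.length + k ∧
      B.length ≤ C.length + k := by
  induction h with
  | refl A => exact ⟨A, List.Sublist.refl _, List.Sublist.refl _, by simp, by simp⟩
  | tail _ s ih =>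
    obtain ⟨C, h1, h2, h3, h4⟩ := ih
    cases s with
    | replace u v a b =>
      obtain ⟨D, d1, d2, d3⟩ := exists_sublist_of_sublist_append_cons h2
      refine ⟨D, d1.trans h1, d2.trans ?_, by omega, ?_⟩
      · exact (List.Sublist.refl _).append (List.sublist_cons_self _ _)
      · simp only [List.length_append, List.length_cons] at h4 ⊢; omega
    | delete u v a =>
      obtain ⟨D, d1, d2, d3⟩ := exists_sublist_of_sublist_append_cons h2
      refine ⟨D, d1.trans h1, d2, by omega, ?_⟩
      simp only [List.length_append, List.length_cons] at h4 ⊢; omega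
    | insert u v a =>
      refine ⟨C, h1, h2.trans ((List.Sublist.refl _).append (List.sublist_cons_self _ _)),
        by omega, ?_⟩
      simp only [List.length_append, List.length_cons] at h4 ⊢; omega

theorem lcsLength_bddAbove (A B : List α) :
    BddAbove {k | ∃ C : List α, C.Sublist A ∧ C.Sublist B ∧ C.length = k} :=
  ⟨A.length, by rintro _ ⟨C, h, -, rfl⟩; exact h.length_le⟩

theorem le_lcsLength {A B C : List α} (h : C.Sublist A) (h' : C.Sublist B) :
    C.length ≤ lcsLength A B :=
  le_csSup (lcsLength_bddAbove A B) ⟨C, h, h', rfl⟩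

theorem exists_sublist_length_eq_lcsLength (A B : List α) :
    ∃ C : List α, C.Sublist A ∧ C.Sublist B ∧ C.length = lcsLength A B :=
  Nat.sSup_mem (s := {k | ∃ C : List α, C.Sublist A ∧ C.Sublist B ∧ C.length = k})
    ⟨0, [], List.nil_sublist _, List.nil_sublist _, rfl⟩ (lcsLength_bddAbove A B)

theorem lcsLength_le_left (A B : List α) : lcsLength A B ≤ A.length := by
  obtain ⟨C, h, -, e⟩ := exists_sublist_length_eq_lcsLength A B
  exact e ▸ h.length_le

/-- Aligning two strings of equal length position by position. -/
theorem editSeq_map_range [DecidableEq α] (f g : ℕ → α) (n : ℕ) :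
    EditSeq {p ∈ Finset.range n | f p ≠ g p}.card ((List.range n).map f) ((List.range n).map g) := by
  induction n with
  | zero => exact .refl _
  | succ n ih =>
    rw [Finset.range_add_one, Finset.filter_insert, List.range_succ, List.map_append,
      List.map_append]
    split_ifs with h
    · rw [Finset.card_insert_of_notMem (by simp)]
      refine (ih.append_right [f n]).tail ?_
      simpa using EditStep.replace ((List.range n).map g) [] (f n) (g n)
    · have := ih.append_right [f n]
      rw [not_not] at h
      simpa [h] using this

theorem exists_sublist_map_range [DecidableEq α] (f g : ℕ → α) (n : ℕ) :
    ∃ C : List α, C.Sublist ((List.range n).map f) ∧ C.Sublist ((List.range n).map g) ∧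
      C.length + {p ∈ Finset.range n | f p ≠ g p}.card = n := by
  induction n with
  | zero => exact ⟨[], by simp⟩
  | succ n ih =>
    obtain ⟨C, h1, h2, h3⟩ := ih
    rw [Finset.range_add_one, Finset.filter_insert, List.range_succ, List.map_append,
      List.map_append]
    split_ifs with h
    · refine ⟨C, h1.trans (List.sublist_append_left _ _), h2.trans (List.sublist_append_left _ _),
        ?_⟩
      rw [Finset.card_insert_of_notMem (by simp)]; omega
    · rw [not_not] at h
      refine ⟨C ++ [f n], h1.append (by simp), h2.append (by simp [h]), ?_⟩
      rw [List.length_append, List.length_singleton]; omega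

theorem sublist_map_range_succ {C : List α} {f : ℕ → α} {a : ℕ}
    (h : C.Sublist ((List.range (a + 1)).map f)) :
    C.Sublist ((List.range a).map f) ∨
      ∃ D : List α, C = D ++ [f a] ∧ D.Sublist ((List.range a).map f) := by
  rw [List.range_succ, List.map_append] at h
  obtain ⟨l₁, l₂, rfl, h1, h2⟩ := List.sublist_append_iff.1 h
  rcases List.sublist_cons_iff.1 h2 with h3 | ⟨l, rfl, h3⟩
  · rw [List.sublist_nil.1 h3, List.append_nil]; exact .inl h1
  · rw [List.map_nil, List.sublist_nil] at h3
    subst h3; exact .inr ⟨l₁, rfl, h1⟩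

end Strings

/-! ### Rigidity of alignments -/

section Rigidity

theorem succ_div_of_mod_eq {r a : ℕ} (hr : 0 < r) (h : a % r = r - 1) :
    (a + 1) / r = a / r + 1 := by
  rw [Nat.succ_div_of_dvd]
  have := Nat.div_add_mod a r
  exact ⟨a / r + 1, by rw [mul_add]; omega⟩

theorem succ_div_of_mod_ne {r a : ℕ} (hr : 0 < r) (h : a % r ≠ r - 1) :
    (a + 1) / r = a / r := by
  rw [Nat.succ_div_of_not_dvd]
  rintro ⟨c, hc⟩
  apply h
  obtain _ | c := c
  · omega
  have : a = (r - 1) + r * c := by rw [mul_add] at hc; omega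
  rw [this, Nat.add_mul_mod_self_left, Nat.mod_eq_of_lt (by omega)]

variable {α : Type*} (E J : ℕ) (f g : ℕ → α) (spec : ℕ → Prop) (zero : ℤ → Prop)
  (Z : ℤ → ℕ → ℕ) (κ : ℕ → ℕ)

/-- Strings are made of blocks of length `4 * E + 1`, in each of which the last symbol is a data
symbol and the others are fillers. Any common subsequence of prefixes of `f` and `g` consists of `m`
matched data symbols and `φ` matched fillers. Here `j` is the shift (in blocks) of the last matched
data symbol and `V` the total variation of these shifts. -/
theorem exists_shift_of_sublist
    (hmatch : ∀ a b, f a = g b →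
      (a % (4 * E + 1) ≠ 4 * E ∧ b % (4 * E + 1) ≠ 4 * E) ∨
      (a % (4 * E + 1) = 4 * E ∧ b % (4 * E + 1) = 4 * E ∧ spec (a / (4 * E + 1)) ∧
        zero ((b / (4 * E + 1) : ℕ) : ℤ)))
    (hZ : ∀ j c, Z j c ≤ Z j (c + 1))
    (hZs : ∀ (j : ℤ) (c : ℕ), spec c → zero (c + j) → Z j c + 1 ≤ Z j (c + 1))
    (hκ : ∀ c, κ c ≤ κ (c + 1)) (hκs : ∀ c, spec c → κ c + 1 ≤ κ (c + 1))
    (hE : ∀ (c : ℕ) (j j' : ℤ), |j| ≤ J → |j'| ≤ J → Z j c ≤ Z j' c + E) :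
    ∀ (a b : ℕ) (C : List α), C.Sublist ((List.range a).map f) → C.Sublist ((List.range b).map g) →
      ∃ (m φ : ℕ) (j V : ℤ), C.length = m + φ ∧ m ≤ κ (a / (4 * E + 1)) ∧ |j| ≤ V ∧
        4 * E * V + |((b : ℤ) - (b / (4 * E + 1) : ℕ)) - ((a : ℤ) - (a / (4 * E + 1) : ℕ)) -
          j * (4 * E)| ≤ ((a : ℤ) - (a / (4 * E + 1) : ℕ)) + ((b : ℤ) - (b / (4 * E + 1) : ℕ)) -
            2 * φ ∧
        (J ≤ V ∨ |j| ≤ J ∧ (m : ℤ) ≤ Z j (a / (4 * E + 1)) + E * V) := by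
  set r := 4 * E + 1 with hr
  have hr0 : 0 < r := by omega
  -- The quantity `a - a / r` is the number of fillers among the first `a` symbols.
  have hbase : ∀ a : ℕ, (0 : ℤ) ≤ (a : ℤ) - (a / r : ℕ) := fun a => by
    have := Nat.div_le_self a r; omega
  have step : ∀ a : ℕ, ((((a + 1 : ℕ) : ℤ) - ((a + 1) / r : ℕ) = ((a : ℤ) - (a / r : ℕ))) ∨
      (((a + 1 : ℕ) : ℤ) - ((a + 1) / r : ℕ) = ((a : ℤ) - (a / r : ℕ)) + 1)) ∧
      (((a + 1) / r = a / r) ∨ ((a + 1) / r = a / r + 1)) := fun a => by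
    by_cases h : a % r = r - 1
    · rw [succ_div_of_mod_eq hr0 h]; push_cast; omega
    · rw [succ_div_of_mod_ne hr0 h]; push_cast; omega
  intro a
  induction a with
  | zero =>
    intro b C hC _
    simp only [List.range_zero, List.map_nil, List.sublist_nil] at hC
    subst hC
    have := hbase b
    refine ⟨0, 0, 0, 0, rfl, by simp, by simp, ?_, .inr ⟨by simp, by simp⟩⟩
    simp only [Nat.zero_div]
    rw [abs_of_nonneg (by push_cast at *; linarith)]
    push_cast at *; linarith
  | succ a iha =>
    intro b
    induction b with
    | zero =>
      intro C _ hC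
      simp only [List.range_zero, List.map_nil, List.sublist_nil] at hC
      subst hC
      have := hbase (a + 1)
      refine ⟨0, 0, 0, 0, rfl, by simp, by simp, ?_, .inr ⟨by simp, by simp⟩⟩
      simp only [Nat.zero_div]
      rw [abs_of_nonpos (by push_cast at *; linarith)]
      push_cast at *; linarith
    | succ b ihb =>
      intro C hCf hCg
      have sa := step a
      have sb := step b
      have mono : κ (a / r) ≤ κ ((a + 1) / r) ∧ ∀ j, Z j (a / r) ≤ Z j ((a + 1) / r) := by
        rcases sa.2 with h | h <;> rw [h]
        · exact ⟨le_rfl, fun _ => le_rfl⟩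
        · exact ⟨hκ _, fun j => hZ j _⟩
      -- Either the last symbol of one prefix can be dropped, which adds at most one unmatched
      -- filler and changes the discrepancy by at most one, or the two last symbols are matched to
      -- each other.
      rcases sublist_map_range_succ hCf with h | ⟨D, rfl, hD⟩
      · obtain ⟨m, φ, j, V, h1, h2, h3, h4, h5⟩ := iha (b + 1) C h hCg
        refine ⟨m, φ, j, V, h1, h2.trans mono.1, h3, ?_, ?_⟩
        · generalize j * (4 * (E : ℤ)) = u at *
          generalize 4 * (E : ℤ) * V = u' at *
          rcases sa.1 with h | h <;> rw [h]
          · exact h4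
          · rw [← le_sub_iff_add_le', abs_le] at *
            constructor <;> linarith [h4.1, h4.2]
        · have := mono.2 j
          refine h5.imp id fun h => ⟨h.1, h.2.trans ?_⟩
          gcongr
      rcases sublist_map_range_succ hCg with h | ⟨D', e, hD'⟩
      · obtain ⟨m, φ, j, V, h1, h2, h3, h4, h5⟩ := ihb _ hCf h
        refine ⟨m, φ, j, V, h1, h2, h3, ?_, h5⟩
        generalize j * (4 * (E : ℤ)) = u at *
        generalize 4 * (E : ℤ) * V = u' at *
        rcases sb.1 with h | h <;> rw [h]
        · exact h4
        · rw [← le_sub_iff_add_le', abs_le] at *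
          constructor <;> linarith [h4.1, h4.2]
      · obtain ⟨rfl, e'⟩ := List.append_inj' e rfl
        rw [List.cons.injEq] at e'
        obtain ⟨m, φ, j, V, h1, h2, h3, h4, h5⟩ := iha b D hD hD'
        have hrr : r - 1 = 4 * E := by omega
        rcases hmatch a b e'.1 with ⟨ha, hb⟩ | ⟨ha, hb, hs, hz⟩
        · rw [← hrr] at ha hb
          refine ⟨m, φ + 1, j, V, by simp [h1]; omega, h2.trans mono.1, h3, ?_, ?_⟩
          · rw [succ_div_of_mod_ne hr0 ha, succ_div_of_mod_ne hr0 hb]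
            simp only [Nat.cast_add, Nat.cast_one]
            have e1 : ((b : ℤ) + 1 - ((b / r : ℕ) : ℤ)) - ((a : ℤ) + 1 - ((a / r : ℕ) : ℤ)) -
              j * (4 * E) = ((b : ℤ) - ((b / r : ℕ) : ℤ)) - ((a : ℤ) - ((a / r : ℕ) : ℤ)) -
              j * (4 * E) := by ring
            rw [e1]; linarith
          · have := mono.2 j
            refine h5.imp id fun h => ⟨h.1, h.2.trans ?_⟩
            gcongr
        · have hda := Nat.div_add_mod a r
          have hdb := Nat.div_add_mod b r
          rw [ha] at hda
          rw [hb] at hdb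
          set A := a / r
          set B := b / r
          have eab : ((b : ℤ) - (B : ℕ)) - ((a : ℤ) - (A : ℕ)) = ((B : ℤ) - A) * (4 * E) := by
            rw [← hda, ← hdb, hr]; push_cast; ring
          rw [← hrr] at ha hb
          rw [succ_div_of_mod_eq hr0 ha, succ_div_of_mod_eq hr0 hb]
          -- At two matched data symbols the filler counts differ by exactly `(B - A) * (4 * E)`, so
          -- the old discrepancy term is `4 * E` times the change of shift and moves into `V`.
          refine ⟨m + 1, φ, (B : ℤ) - A, V + |((B : ℤ) - A) - j|, by simp [h1]; omega,
            (Nat.add_le_add_right h2 1).trans (hκs _ hs), ?_, ?_, ?_⟩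
          · have := abs_add_le j (((B : ℤ) - A) - j)
            rw [add_sub_cancel] at this; linarith
          · have e1 : (((b + 1 : ℕ) : ℤ) - ((B + 1 : ℕ) : ℤ)) -
              (((a + 1 : ℕ) : ℤ) - ((A + 1 : ℕ) : ℤ)) - ((B : ℤ) - A) * (4 * E) = 0 := by
              rw [← eab]; push_cast; ring
            rw [e1, abs_zero]
            rw [eab, ← sub_mul, abs_mul, abs_of_nonneg (show (0 : ℤ) ≤ 4 * E by positivity)] at h4
            simp only [Nat.cast_add, Nat.cast_one]
            linarith
          · have hj' := abs_nonneg (((B : ℤ) - A) - j)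
            rcases h5 with h5 | ⟨h5, h6⟩
            · exact .inl (h5.trans (by linarith))
            by_cases hJ : |(B : ℤ) - A| ≤ J
            · right
              refine ⟨hJ, ?_⟩
              have hz' := hZs ((B : ℤ) - A) A hs (by rw [add_sub_cancel]; exact hz)
              -- A proper change of shift raises `V` by at least one, and the resulting extra `E`
              -- covers the difference between the counts `Z` at the two shifts.
              by_cases hjj : (B : ℤ) - A = j
              · rw [hjj] at hz' ⊢
                simp only [sub_self, abs_zero, add_zero]
                push_cast; zify at hz'; linarith
              · have h7 := hE A j _ h5 hJ
                have h8 : 1 ≤ |((B : ℤ) - A) - j| := Int.one_le_abs (sub_ne_zero.2 hjj)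
                have h9 : (E : ℤ) * 1 ≤ E * |((B : ℤ) - A) - j| :=
                  mul_le_mul_of_nonneg_left h8 (by positivity)
                zify at hz' h7
                push_cast
                linarith
            · left
              have := abs_add_le j (((B : ℤ) - A) - j)
              rw [add_sub_cancel] at this; push Not at hJ; linarith

/-- If the numbers `Z j c` of matching data symbols at shift `j` vary by at most `E`, then no common
subsequence is longer than that of the unshifted alignment. -/
theorem length_add_le_of_sublist {n w : ℕ} {C : List α}
    (hmatch : ∀ a b, f a = g b →
      (a % (4 * E + 1) ≠ 4 * E ∧ b % (4 * E + 1) ≠ 4 * E) ∨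
      (a % (4 * E + 1) = 4 * E ∧ b % (4 * E + 1) = 4 * E ∧ spec (a / (4 * E + 1)) ∧
        zero ((b / (4 * E + 1) : ℕ) : ℤ)))
    (hZ : ∀ j c, Z j c ≤ Z j (c + 1))
    (hZs : ∀ (j : ℤ) (c : ℕ), spec c → zero (c + j) → Z j c + 1 ≤ Z j (c + 1))
    (hκ : ∀ c, κ c ≤ κ (c + 1)) (hκs : ∀ c, spec c → κ c + 1 ≤ κ (c + 1))
    (hE : ∀ (c : ℕ) (j j' : ℤ), |j| ≤ J → |j'| ≤ J → Z j c ≤ Z j' c + E)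
    (hJ : ∀ c, κ c ≤ 2 * E * J) (hnw : n ≤ w)
    (hCf : C.Sublist ((List.range n).map f)) (hCg : C.Sublist ((List.range w).map g)) :
    C.length + n / (4 * E + 1) ≤ w + Z 0 (n / (4 * E + 1)) := by
  obtain ⟨m, φ, j, V, h1, h2, h3, h4, h5⟩ :=
    exists_shift_of_sublist E J f g spec zero Z κ hmatch hZ hZs hκ hκs hE n w C hCf hCg
  have h4' := (le_add_of_nonneg_right (abs_nonneg _)).trans h4
  have hdiv : n / (4 * E + 1) ≤ w / (4 * E + 1) := Nat.div_le_div_right hnw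
  have hm := hJ (n / (4 * E + 1))
  rw [h1]
  zify at *
  -- If `J ≤ V`, the `2 * E * V` lost matches outweigh all special symbols. Otherwise half of the
  -- loss pays for the term `E * V`, and the other half for passing from shift `j` to shift `0`, as
  -- `1 ≤ V` if `j ≠ 0`.
  rcases h5 with h5 | ⟨h5, h6⟩
  · have : (E : ℤ) * J ≤ E * V := mul_le_mul_of_nonneg_left h5 (by positivity)
    nlinarith
  · have hE0 : (Z j (n / (4 * E + 1)) : ℤ) ≤ Z 0 (n / (4 * E + 1)) + E * V := by
      by_cases hj : j = 0
      · subst hj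
        have : 0 ≤ (E : ℤ) * V := mul_nonneg (by positivity) ((abs_nonneg _).trans h3)
        linarith
      · have := hE (n / (4 * E + 1)) j 0 h5 (by simp)
        have h8 : 1 ≤ V := (Int.one_le_abs hj).trans h3
        have h9 : (E : ℤ) * 1 ≤ E * V := mul_le_mul_of_nonneg_left h8 (by positivity)
        linarith
    linarith

end Rigidity

/-! ### The hard instances -/

/-- Alignments are analysed backwards from the latest symbol, so that the unshifted alignment pairs
equal indices. -/
theorem reverse_map_range {α : Type*} (f : ℕ → α) (n : ℕ) :
    ((List.range n).map f).reverse = (List.range n).map fun p => f (n - 1 - p) := by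
  apply List.ext_getElem
  · simp
  · intro i h1 h2
    simp

theorem reverse_substream {α : Type*} (S : ℕ → α) (i m : ℕ) :
    (substream S i m).reverse = (List.range (m - i)).map fun b => S (m - 1 - b) := by
  apply List.ext_getElem
  · simp [substream]
  · intro b h1 h2
    simp only [substream, List.length_reverse, List.length_map, List.Ico.length] at h1
    simp only [substream, List.getElem_reverse, List.getElem_map, List.length_map,
      List.Ico, List.getElem_range', List.getElem_range, List.length_range']
    congr 1; omega

/-- Needed because the value at the midpoint of an interval enters the code: with at most `n + 1`
possibilities it costs only `log (n + 1)`. -/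
theorem StreamProblem.value_le {n q : ℕ} (P : StreamProblem) (F : Fin n → Fin q)
    (S : ℕ → Fin q) {m : ℕ} (hn : 0 < n) (hm : n ≤ m) : P.value F S m ≤ n := by
  cases P with
  | editDistance =>
    refine (Nat.sInf_le (s := {d | ∃ i < m, d = editDist (List.ofFn F) (substream S i m)})
      ⟨m - n, by omega, rfl⟩).trans ?_
    have h0 : 0 < q := (Nat.zero_le _).trans_lt (F ⟨0, hn⟩).2
    set f : ℕ → Fin q := fun p => if h : p < n then F ⟨p, h⟩ else ⟨0, h0⟩
    have e1 : List.ofFn F = (List.range n).map f := by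
      apply List.ext_getElem
      · simp
      · intro i h1 h2
        have : i < n := by simpa using h1
        simp [f, this]
    have e2 : substream S (m - n) m = (List.range n).map fun p => S (m - n + p) := by
      apply List.ext_getElem
      · simp [substream]; omega
      · intro i h1 h2
        simp [substream, List.Ico]
    rw [e1, e2]
    refine (editDist_le (editSeq_map_range _ _ n)).trans ?_
    exact (Finset.card_filter_le _ _).trans_eq (Finset.card_range n)
  | lcs => exact (lcsLength_le_left _ _).trans_eq (List.length_ofFn)

/-- The symbol of the hard pattern at distance `d` from its end: blocks of length `r` that consist
of a data symbol and fillers `2`; the data symbol is `0` in the special blocks `2 ^ (K + s)`. -/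
def patternLetter (K r d : ℕ) : Fin 4 :=
  if d % r = r - 1 then (if ∃ s < K, d / r = 2 ^ (K + s) then 0 else 3) else 2

/-- The hard pattern. -/
def hardPattern {q : ℕ} (hq : 4 ≤ q) (K r n : ℕ) : Fin n → Fin q :=
  fun p => Fin.castLE hq (patternLetter K r (n - 1 - p))

/-- The symbol of a hard stream at position `p`: blocks of length `r` that consist of a data bit and
fillers `2`, where the block `2 * n` starts at position `2 * n`. -/
def streamLetter (n r : ℕ) (x : ℕ → Bool) (p : ℕ) : Fin 4 :=
  if (p + 2 * n * (r - 1)) % r = 0 then (if x ((p + 2 * n * (r - 1)) / r) then 1 else 0) else 2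

/-- The hard stream with data bits `x`. -/
def hardStream {q : ℕ} (hq : 4 ≤ q) (n r : ℕ) (x : ℕ → Bool) : ℕ → Fin q :=
  fun p => Fin.castLE hq (streamLetter n r x p)

/-- The symbol of a hard stream at distance `d` from the end of block `β`. -/
def streamLetterRev (r : ℕ) (x : ℕ → Bool) (β d : ℕ) : Fin 4 :=
  if d % r = r - 1 then (if x ((β : ℤ) - (d / r : ℕ)).toNat then 1 else 0) else 2

theorem streamLetter_eq (n r τ d : ℕ) (x : ℕ → Bool) (hr : 0 < r)
    (hd : d < 2 * n + (τ + 1) * r) :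
    streamLetter n r x (2 * n + (τ + 1) * r - 1 - d) = streamLetterRev r x (2 * n + τ) d := by
  have hdm := Nat.div_add_mod d r
  have ho := Nat.mod_lt d hr
  have hc : d / r ≤ 2 * n + τ := by
    rw [← Nat.lt_succ_iff, Nat.div_lt_iff_lt_mul hr]
    refine hd.trans_le ?_
    nlinarith
  obtain ⟨e, he⟩ := Nat.exists_eq_add_of_le hc
  set c := d / r
  set o := d % r
  have hp : 2 * n + (τ + 1) * r - 1 - d + 2 * n * (r - 1) = (r - 1 - o) + r * e := by
    obtain ⟨r', rfl⟩ : ∃ r', r = r' + 1 := ⟨r - 1, by omega⟩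
    have h1 : (2 * n + τ) * (r' + 1) = (c + e) * (r' + 1) := by rw [he]
    simp only [add_tsub_cancel_right]
    have h2 : (2 * n + τ) * (r' + 1) = 2 * n * r' + 2 * n + τ * (r' + 1) := by ring
    have h3 : (c + e) * (r' + 1) = (r' + 1) * c + (r' + 1) * e := by ring
    have h4 : (τ + 1) * (r' + 1) = τ * (r' + 1) + (r' + 1) := by ring
    omega
  unfold streamLetter streamLetterRev
  rw [hp, Nat.add_mul_mod_self_left, Nat.add_mul_div_left _ _ hr,
    Nat.mod_eq_of_lt (show r - 1 - o < r by omega),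
    Nat.div_eq_of_lt (show r - 1 - o < r by omega), he]
  have h1 : (r - 1 - o = 0) ↔ (o = r - 1) := by omega
  have h2 : (((c + e : ℕ) : ℤ) - (c : ℕ)).toNat = 0 + e := by push_cast; omega
  rw [h2]
  simp only [h1]
  rfl

/-- The number of special blocks at which the pattern matches, if its end is aligned with the end
of block `β`. -/
def zeroCount (K : ℕ) (x : ℕ → Bool) (β : ℕ) : ℕ :=
  {s ∈ Finset.range K | x (β - 2 ^ (K + s)) = false}.card

/-- The data bits at the special blocks are balanced for all small shifts. -/
def BalancedAt (K E : ℕ) (x : ℕ → Bool) (β : ℕ) : Prop :=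
  ∀ k ≤ K, ∀ j : ℤ, |j| ≤ K →
    |∑ s ∈ Finset.range k,
      (if x ((β : ℤ) - ((2 ^ (K + s) : ℕ) + j)).toNat then (1 : ℤ) else -1)| ≤ E

/-- The special blocks increase with `s`, so cutting at block `c` leaves an initial segment of them.
This is why `BalancedAt` speaks of all partial sums. -/
theorem exists_forall_two_pow_lt_iff (a K c : ℕ) :
    ∃ k ≤ K, ∀ s < K, (2 ^ (a + s) < c ↔ s < k) := by
  induction K with
  | zero => exact ⟨0, le_rfl, by simp⟩
  | succ K ih =>
    by_cases h : 2 ^ (a + K) < c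
    · refine ⟨K + 1, le_rfl, fun s hs => ⟨fun _ => hs, fun _ => lt_of_le_of_lt ?_ h⟩⟩
      exact Nat.pow_le_pow_right (by norm_num) (by omega)
    · obtain ⟨k, hk, h'⟩ := ih
      refine ⟨k, by omega, fun s hs => ?_⟩
      rcases Nat.lt_succ_iff_lt_or_eq.1 hs with hs | rfl
      · exact h' s hs
      · exact ⟨fun h2 => (h h2).elim, fun h2 => by omega⟩

/-- The number of special blocks before block `c` at which the pattern matches at shift `j`. -/
def shiftedZeroCount (K : ℕ) (x : ℕ → Bool) (β : ℕ) (j : ℤ) (c : ℕ) : ℕ :=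
  {s ∈ Finset.range K | 2 ^ (K + s) < c ∧
    x ((β : ℤ) - ((2 ^ (K + s) : ℕ) + j)).toNat = false}.card

/-- Twice the number of zeros is `k` minus the sum of signs. Two such sums in `[-E, E]` differ by at
most `2 * E`, hence the counts by at most `E`. -/
theorem BalancedAt.shiftedZeroCount_le {K E : ℕ} {x : ℕ → Bool} {β : ℕ} (h : BalancedAt K E x β)
    (c : ℕ) (j j' : ℤ) (hj : |j| ≤ K) (hj' : |j'| ≤ K) :
    shiftedZeroCount K x β j c ≤ shiftedZeroCount K x β j' c + E := by
  obtain ⟨k, hk, hkc⟩ := exists_forall_two_pow_lt_iff K K c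
  have key : ∀ j, 2 * (shiftedZeroCount K x β j c : ℤ) = k - ∑ s ∈ Finset.range k,
      (if x ((β : ℤ) - ((2 ^ (K + s) : ℕ) + j)).toNat then (1 : ℤ) else -1) := by
    intro j
    have e : shiftedZeroCount K x β j c = {s ∈ Finset.range k |
        x ((β : ℤ) - ((2 ^ (K + s) : ℕ) + j)).toNat = false}.card := by
      unfold shiftedZeroCount
      congr 1
      ext s
      simp only [Finset.mem_filter, Finset.mem_range]
      constructor
      · rintro ⟨h1, h2, h3⟩
        exact ⟨(hkc s h1).1 h2, h3⟩
      · rintro ⟨h1, h2⟩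
        exact ⟨by omega, (hkc s (by omega)).2 h1, h2⟩
    rw [e, Finset.card_filter]
    have : (k : ℤ) = ∑ s ∈ Finset.range k, 1 := by simp
    rw [this, ← Finset.sum_sub_distrib]
    push_cast
    rw [Finset.mul_sum]
    refine Finset.sum_congr rfl fun s _ => ?_
    cases x ((β : ℤ) - (2 ^ (K + s) + j)).toNat <;> simp
  have h1 := key j
  have h2 := key j'
  have h3 := abs_le.1 (h k hk j hj)
  have h4 := abs_le.1 (h k hk j' hj')
  zify
  linarith [h3.1, h4.2]

/-! ### The value on balanced streams -/

section

variable {K E n τ : ℕ} {x : ℕ → Bool}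

theorem shiftedZeroCount_zero (hN : 2 ^ (2 * K) ≤ n) (β : ℕ) :
    shiftedZeroCount K x β 0 n = zeroCount K x β := by
  unfold shiftedZeroCount zeroCount
  congr 1
  ext s
  simp only [Finset.mem_filter, Finset.mem_range, add_zero]
  have e : ((β : ℤ) - (2 ^ (K + s) : ℕ)).toNat = β - 2 ^ (K + s) := by omega
  rw [e]
  constructor
  · rintro ⟨h1, -, h2⟩; exact ⟨h1, h2⟩
  · rintro ⟨h1, h2⟩
    refine ⟨h1, lt_of_lt_of_le ?_ hN, h2⟩
    exact Nat.pow_lt_pow_right (by norm_num) (by omega)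

/-- Rigidity with `J = K`: there are only `K` special blocks and `K ≤ 2 * E * K`. Allowing any `w ≥
n` covers the longer suffixes in the edit distance problem. -/
theorem length_add_div_le (hE : 1 ≤ E) (hN : 2 ^ (2 * K) ≤ n / (4 * E + 1))
    (β : ℕ) (h : BalancedAt K E x β) {w : ℕ} (hnw : n ≤ w) {C : List (Fin 4)}
    (hCf : C.Sublist ((List.range n).map (patternLetter K (4 * E + 1))))
    (hCg : C.Sublist ((List.range w).map (streamLetterRev (4 * E + 1) x β))) :
    C.length + n / (4 * E + 1) ≤ w + zeroCount K x β := by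
  rw [← shiftedZeroCount_zero hN]
  refine length_add_le_of_sublist E K _ _ (fun c => ∃ s < K, c = 2 ^ (K + s))
    (fun e => x ((β : ℤ) - e).toNat = false) (shiftedZeroCount K x β)
    (fun c => {s ∈ Finset.range K | 2 ^ (K + s) < c}.card) ?_ ?_ ?_ ?_ ?_
    h.shiftedZeroCount_le ?_ hnw hCf hCg
  · intro a b hab
    unfold patternLetter streamLetterRev at hab
    simp only [add_tsub_cancel_right] at hab
    by_cases ha : a % (4 * E + 1) = 4 * E <;> by_cases hb : b % (4 * E + 1) = 4 * E
    · right
      rw [if_pos ha, if_pos hb] at hab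
      refine ⟨ha, hb, ?_, ?_⟩
      · by_contra hs
        rw [if_neg hs] at hab
        split_ifs at hab <;> exact absurd hab (by decide)
      · by_contra hz
        rw [Bool.not_eq_false] at hz
        rw [if_pos hz] at hab
        split_ifs at hab <;> exact absurd hab (by decide)
    · rw [if_pos ha, if_neg hb] at hab
      split_ifs at hab <;> exact absurd hab (by decide)
    · rw [if_neg ha, if_pos hb] at hab
      split_ifs at hab <;> exact absurd hab (by decide)
    · exact .inl ⟨ha, hb⟩
  · intro j c
    refine Finset.card_le_card fun s hs => ?_
    simp only [Finset.mem_filter] at hs ⊢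
    exact ⟨hs.1, by omega, hs.2.2⟩
  · rintro j c ⟨s, hs, rfl⟩ hz
    rw [Nat.add_one_le_iff]
    refine Finset.card_lt_card (Finset.ssubset_iff.2 ⟨s, by simp, fun t ht => ?_⟩)
    rcases Finset.mem_insert.1 ht with rfl | ht
    · simp only [Finset.mem_filter, Finset.mem_range]
      exact ⟨hs, by omega, hz⟩
    · simp only [Finset.mem_filter] at ht ⊢
      exact ⟨ht.1, by omega, ht.2.2⟩
  · intro c
    refine Finset.card_le_card fun s hs => ?_
    simp only [Finset.mem_filter] at hs ⊢
    exact ⟨hs.1, by omega⟩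
  · rintro c ⟨s, hs, rfl⟩
    rw [Nat.add_one_le_iff]
    refine Finset.card_lt_card (Finset.ssubset_iff.2 ⟨s, by simp, fun t ht => ?_⟩)
    rcases Finset.mem_insert.1 ht with rfl | ht
    · simp only [Finset.mem_filter, Finset.mem_range]
      exact ⟨hs, by omega⟩
    · simp only [Finset.mem_filter] at ht ⊢
      exact ⟨ht.1, by omega⟩
  · intro c
    refine (Finset.card_filter_le _ _).trans ?_
    rw [Finset.card_range]
    nlinarith

/-- In the unshifted alignment fillers meet fillers. Mismatches occur only at the `n / r` data
symbols, and never at a special block with data bit zero. -/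
theorem card_mismatch_add_zeroCount_le {r : ℕ} (hr : 0 < r) (hN : 2 ^ (2 * K) ≤ n / r) (β : ℕ) :
    {d ∈ Finset.range n | patternLetter K r d ≠ streamLetterRev r x β d}.card + zeroCount K x β ≤
      n / r := by
  have hinj : Function.Injective fun s => 2 ^ (K + s) := fun s t h => by
    have := Nat.pow_right_injective (le_refl 2) h
    omega
  set Y := Finset.image (fun s => 2 ^ (K + s)) {s ∈ Finset.range K | x (β - 2 ^ (K + s)) = false}
    with hY
  have hYc : Y.card = zeroCount K x β := Finset.card_image_of_injective _ hinj
  have hYs : Y ⊆ Finset.range (n / r) := by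
    intro c hc
    obtain ⟨s, hs, rfl⟩ := Finset.mem_image.1 hc
    simp only [Finset.mem_filter, Finset.mem_range] at hs ⊢
    exact lt_of_lt_of_le (Nat.pow_lt_pow_right (by norm_num) (by omega)) hN
  have hc := Finset.card_sdiff_add_card_eq_card hYs
  rw [Finset.card_range, hYc] at hc
  rw [← hc]
  refine Nat.add_le_add_right ?_ _
  refine Finset.card_le_card_of_injOn (fun d => d / r) ?_ ?_
  · intro d hd
    simp only [Finset.coe_filter, Finset.mem_range, Set.mem_ofPred_eq] at hd
    obtain ⟨hd, hne⟩ := hd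
    unfold patternLetter streamLetterRev at hne
    have hdr : d % r = r - 1 := by
      by_contra h
      simp [h] at hne
    simp only [if_pos hdr] at hne
    simp only [Finset.coe_sdiff, Set.mem_sdiff, Finset.coe_range, Set.mem_Iio, Finset.mem_coe]
    refine ⟨?_, fun h => ?_⟩
    · rw [← Nat.add_one_le_iff, ← succ_div_of_mod_eq hr hdr]
      exact Nat.div_le_div_right hd
    · obtain ⟨s, hs, hsd⟩ := Finset.mem_image.1 h
      simp only [Finset.mem_filter, Finset.mem_range] at hs
      have e : ((β : ℤ) - (d / r : ℕ)).toNat = β - 2 ^ (K + s) := by rw [← hsd]; omega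
      rw [if_pos ⟨s, hs.1, hsd.symm⟩, e, hs.2] at hne
      exact hne rfl
  · intro d hd d' hd' h
    simp only [Finset.coe_filter, Finset.mem_range, Set.mem_ofPred_eq] at hd hd'
    have aux : ∀ d, patternLetter K r d ≠ streamLetterRev r x β d → d % r = r - 1 := by
      intro d hne
      unfold patternLetter streamLetterRev at hne
      by_contra h
      simp [h] at hne
    have h1 := aux _ hd.2
    have h2 := aux _ hd'.2
    dsimp only at h
    rw [← Nat.div_add_mod d r, ← Nat.div_add_mod d' r, h, h1, h2]

variable {q : ℕ} (hq : 4 ≤ q)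

theorem reverse_ofFn_hardPattern (r : ℕ) :
    (List.ofFn (hardPattern hq K r n)).reverse =
      ((List.range n).map (patternLetter K r)).map (Fin.castLE hq) := by
  apply List.ext_getElem
  · simp
  · intro i h1 h2
    have : i < n := by simpa using h1
    simp only [List.getElem_reverse, List.getElem_ofFn, List.length_ofFn, hardPattern,
      List.getElem_map, List.getElem_range]
    congr 2; omega

theorem reverse_substream_hardStream {r : ℕ} (hr : 0 < r) (i : ℕ) :
    (substream (hardStream hq n r x) i (2 * n + (τ + 1) * r)).reverse =
      ((List.range (2 * n + (τ + 1) * r - i)).map (streamLetterRev r x (2 * n + τ))).map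
        (Fin.castLE hq) := by
  rw [reverse_substream, List.map_map]
  refine List.map_congr_left fun b hb => ?_
  have hb := List.mem_range.1 hb
  simp only [hardStream, Function.comp]
  rw [streamLetter_eq _ _ _ _ _ hr (by omega)]

theorem exists_sublist_of_sublist_map {α β : Type*} {h : α → β} {A : List α} {C : List β}
    (hC : C.Sublist (A.map h)) : ∃ D : List α, D.Sublist A ∧ D.map h = C := by
  obtain ⟨D, hD, e⟩ := List.sublist_map_iff.1 hC
  exact ⟨D, hD, e.symm⟩

/-- The output that is asked for after block `τ` if the data bits are balanced. -/
theorem value_hardPattern_hardStream (P : StreamProblem) (hE : 1 ≤ E)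
    (hN : 2 ^ (2 * K) ≤ n / (4 * E + 1)) (h : BalancedAt K E x (2 * n + τ)) :
    (P.value (hardPattern hq K (4 * E + 1) n) (hardStream hq n (4 * E + 1) x)
      (2 * n + (τ + 1) * (4 * E + 1)) : ℤ) =
    match P with
    | .editDistance => (n / (4 * E + 1) : ℕ) - zeroCount K x (2 * n + τ)
    | .lcs => n - ((n / (4 * E + 1) : ℕ) - zeroCount K x (2 * n + τ)) := by
  have hcastinj : Function.Injective (Fin.castLE hq) := Fin.castLE_injective hq
  have hr : 0 < 4 * E + 1 := by omega
  have hpos : 0 < 2 ^ (2 * K) := by positivity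
  have hn : n / (4 * E + 1) ≤ n := Nat.div_le_self _ _
  have hmis := card_mismatch_add_zeroCount_le (x := x) hr hN (2 * n + τ)
  set r := 4 * E + 1 with hrdef
  set m := 2 * n + (τ + 1) * r with hm
  set F := hardPattern hq K r n
  set S := hardStream hq n r x
  have hnm : n ≤ m := by omega
  have lower : ∀ i ≤ m, ∀ C : List (Fin q), C.Sublist (List.ofFn F) →
      C.Sublist (substream S i m) → C.length + n / r ≤ max n (m - i) + zeroCount K x (2 * n + τ) := by
    intro i hi C hC hC'
    have h1 := List.reverse_sublist.2 hC
    have h2 := List.reverse_sublist.2 hC'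
    rw [reverse_ofFn_hardPattern] at h1
    rw [reverse_substream_hardStream hq hr] at h2
    obtain ⟨D, hD, e⟩ := exists_sublist_of_sublist_map h1
    rw [← e] at h2
    obtain ⟨D', hD', e'⟩ := exists_sublist_of_sublist_map h2
    have : D' = D := List.map_injective_iff.2 hcastinj e'
    subst this
    have hl : D'.length = C.length := by rw [← List.length_map (Fin.castLE hq), e]; simp
    rw [← hl]
    -- A suffix shorter than `n` is prolonged to `n` symbols, which keeps the common subsequence;
    -- `streamLetterRev` makes sense at every distance.
    refine length_add_div_le hE hN _ h (le_max_left n (m - i)) hD (hD'.trans ?_)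
    refine List.Sublist.map _ (List.range_sublist.2 (le_max_right _ _))
  have eF : List.ofFn F = ((List.range n).map fun p => Fin.castLE hq (patternLetter K r (n - 1 - p))) := by
    rw [← List.reverse_reverse (List.ofFn F), reverse_ofFn_hardPattern, List.map_map,
      reverse_map_range]
    rfl
  have eS : substream S (m - n) m =
      ((List.range n).map fun p => Fin.castLE hq (streamLetterRev r x (2 * n + τ) (n - 1 - p))) := by
    rw [← List.reverse_reverse (substream S _ _), reverse_substream_hardStream hq hr, List.map_map,
      show 2 * n + (τ + 1) * r - (m - n) = n by omega, reverse_map_range]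
    rfl
  have ecard : {p ∈ Finset.range n | Fin.castLE hq (patternLetter K r (n - 1 - p)) ≠
      Fin.castLE hq (streamLetterRev r x (2 * n + τ) (n - 1 - p))}.card =
      {d ∈ Finset.range n | patternLetter K r d ≠ streamLetterRev r x (2 * n + τ) d}.card := by
    simp only [ne_eq, hcastinj.eq_iff, Finset.card_filter]
    exact Finset.sum_range_reflect
      (fun d => if ¬ patternLetter K r d = streamLetterRev r x (2 * n + τ) d then 1 else 0) n
  cases P with
  | editDistance =>
    simp only [StreamProblem.value]
    have hle : sInf {d | ∃ i < m, d = editDist (List.ofFn F) (substream S i m)} ≤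
        {d ∈ Finset.range n | patternLetter K r d ≠ streamLetterRev r x (2 * n + τ) d}.card := by
      refine (Nat.sInf_le (s := {d | ∃ i < m, d = editDist (List.ofFn F) (substream S i m)})
        ⟨m - n, by omega, rfl⟩).trans ?_
      rw [eF, eS, ← ecard]
      exact editDist_le (editSeq_map_range _ _ n)
    obtain ⟨i, hi, e⟩ := Nat.sInf_mem
      (s := {d | ∃ i < m, d = editDist (List.ofFn F) (substream S i m)}) ⟨_, m - n, by omega, rfl⟩
    obtain ⟨C, c1, c2, c3, c4⟩ := (editSeq_editDist (List.ofFn F) (substream S i m)).exists_sublist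
    have h5 := lower i hi.le C c1 c2
    rw [← e] at c3 c4
    simp only [List.length_ofFn, substream, List.length_map, List.Ico.length] at c3 c4
    have h6 : max n (m - i) ≤ C.length +
      sInf {d | ∃ i < m, d = editDist (List.ofFn F) (substream S i m)} := max_le c3 c4
    omega
  | lcs =>
    simp only [StreamProblem.value]
    obtain ⟨C, c1, c2, c3⟩ := exists_sublist_length_eq_lcsLength (List.ofFn F)
      (substream S (m - n) m)
    have h5 := lower (m - n) (by omega) C c1 c2
    rw [show m - (m - n) = n by omega, max_self] at h5
    obtain ⟨D, d1, d2, d3⟩ := exists_sublist_map_range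
      (fun p => Fin.castLE hq (patternLetter K r (n - 1 - p)))
      (fun p => Fin.castLE hq (streamLetterRev r x (2 * n + τ) (n - 1 - p))) n
    rw [← eF] at d1
    rw [← eS] at d2
    rw [ecard] at d3
    have h6 := le_lcsLength d1 d2
    omega

end

/-! ### Concentration of sums of random signs -/

/-- The sum factors over the coordinates, and `cosh l ≤ exp (l ^ 2 / 2)` bounds each factor. -/
theorem sum_exp_sum_sign_le {ι : Type*} [Fintype ι] [DecidableEq ι] (I : Finset ι) (l : ℝ) :
    ∑ x : ι → Bool, Real.exp (l * ∑ i ∈ I, (if x i then (1 : ℝ) else -1)) ≤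
      2 ^ Fintype.card ι * Real.exp (I.card * (l ^ 2 / 2)) := by
  have h1 : ∀ x : ι → Bool, Real.exp (l * ∑ i ∈ I, (if x i then (1 : ℝ) else -1)) =
      ∏ i, (if i ∈ I then Real.exp (l * (if x i then (1 : ℝ) else -1)) else 1) := by
    intro x
    rw [Finset.mul_sum, Real.exp_sum, Finset.prod_ite_mem, Finset.univ_inter]
  simp only [h1]
  have h2 := Finset.prod_univ_sum (fun _ : ι => (Finset.univ : Finset Bool)) fun i b =>
    (if i ∈ I then Real.exp (l * (if b then (1 : ℝ) else -1)) else 1)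
  rw [Fintype.piFinset_univ] at h2
  rw [← h2]
  have h3 : (2 : ℝ) ^ Fintype.card ι * Real.exp (I.card * (l ^ 2 / 2)) =
      ∏ i : ι, 2 * (if i ∈ I then Real.exp (l ^ 2 / 2) else 1) := by
    rw [Finset.prod_mul_distrib, Finset.prod_const, Finset.card_univ, Finset.prod_ite_mem,
      Finset.univ_inter, Finset.prod_const, ← Real.exp_nat_mul]
  rw [h3]
  refine Finset.prod_le_prod (fun i _ => Finset.sum_nonneg fun b _ => by positivity) fun i _ => ?_
  rw [Fintype.sum_bool]
  by_cases hi : i ∈ I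
  · have := Real.cosh_le_exp_half_sq l
    rw [Real.cosh_eq] at this
    simp only [hi, if_true, mul_one, Bool.false_eq_true, if_false, mul_neg]
    linarith
  · simp only [hi, if_false]
    norm_num

theorem card_lt_abs_sum_sign_le {ι : Type*} [Fintype ι] [DecidableEq ι] (I : Finset ι) {K E : ℕ}
    (hK : 0 < K) (hI : I.card ≤ K) :
    ({x : ι → Bool | (E : ℤ) < |∑ i ∈ I, (if x i then (1 : ℤ) else -1)|} : Finset _).card ≤
      2 ^ Fintype.card ι * (2 * Real.exp (-(E ^ 2 / (2 * K)))) := by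
  have hK' : (0 : ℝ) < K := by exact_mod_cast hK
  -- This choice minimises the exponent `K * l ^ 2 / 2 - l * E` in Chernoff's bound.
  set l : ℝ := E / K with hl
  have hl0 : 0 ≤ l := by positivity
  rw [Finset.card_filter]
  push_cast
  have h1 : ∀ x : ι → Bool,
      (if (E : ℤ) < |∑ i ∈ I, (if x i then (1 : ℤ) else -1)| then (1 : ℝ) else 0) ≤
      Real.exp (-(l * E)) * (Real.exp (l * ∑ i ∈ I, (if x i then (1 : ℝ) else -1)) +
        Real.exp (-l * ∑ i ∈ I, (if x i then (1 : ℝ) else -1))) := by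
    intro x
    split_ifs with h
    · have h' : (E : ℝ) < |∑ i ∈ I, (if x i then (1 : ℝ) else -1)| := by exact_mod_cast h
      set s := ∑ i ∈ I, (if x i then (1 : ℝ) else -1)
      rw [mul_add, ← Real.exp_add, ← Real.exp_add]
      rcases lt_abs.1 h' with h' | h'
      · have : 1 ≤ Real.exp (-(l * E) + l * s) := by
          rw [Real.one_le_exp_iff]; nlinarith
        linarith [Real.exp_pos (-(l * E) + -l * s)]
      · have : 1 ≤ Real.exp (-(l * E) + -l * s) := by
          rw [Real.one_le_exp_iff]; nlinarith
        linarith [Real.exp_pos (-(l * E) + l * s)]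
    · positivity
  refine (Finset.sum_le_sum fun x _ => h1 x).trans ?_
  rw [← Finset.mul_sum, Finset.sum_add_distrib]
  have h2 := sum_exp_sum_sign_le I l
  have h3 := sum_exp_sum_sign_le I (-l)
  rw [neg_sq] at h3
  have h4 : Real.exp (I.card * (l ^ 2 / 2)) ≤ Real.exp (K * (l ^ 2 / 2)) := by
    rw [Real.exp_le_exp]; gcongr
  have h5 : Real.exp (-(E ^ 2 / (2 * K))) = Real.exp (-(l * E)) * Real.exp (K * (l ^ 2 / 2)) := by
    rw [← Real.exp_add, hl]
    congr 1
    field_simp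
    ring
  rw [h5]
  calc _ ≤ Real.exp (-(l * E)) * (2 ^ Fintype.card ι * Real.exp (K * (l ^ 2 / 2)) +
        2 ^ Fintype.card ι * Real.exp (K * (l ^ 2 / 2))) := by
        gcongr
        · exact h2.trans (by gcongr)
        · exact h3.trans (by gcongr)
    _ = _ := by ring

/-- The extension of a finite sequence of bits by zeros. -/
def extendBits {N : ℕ} (x : Fin N → Bool) (i : ℕ) : Bool :=
  if h : i < N then x ⟨i, h⟩ else false

-- For a fixed shift the positions of the special bits are distinct, so the signs are independent.
-- The union bound runs over `K + 1` lengths and `2 * K + 1` shifts; the conditions on `β` and `N`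
-- keep all positions inside the bit string.
open Classical in
theorem card_not_balancedAt_le {K E N β : ℕ} (hK : 0 < K) (hβ : 2 ^ (2 * K) + K ≤ β)
    (hN : β + K < N) :
    ({x : Fin N → Bool | ¬ BalancedAt K E (extendBits x) β} : Finset _).card ≤
      2 ^ N * ((K + 1) * (2 * K + 1) * (2 * Real.exp (-(E ^ 2 / (2 * K))))) := by
  set pos : ℤ → ℕ → ℕ := fun j s => ((β : ℤ) - ((2 ^ (K + s) : ℕ) + j)).toNat with hpos
  set B : ℕ → ℤ → Finset (Fin N → Bool) := fun k j =>
    {x | (E : ℤ) < |∑ s ∈ Finset.range k, (if extendBits x (pos j s) then (1 : ℤ) else -1)|}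
  have hsub : ({x : Fin N → Bool | ¬ BalancedAt K E (extendBits x) β} : Finset _) ⊆
      (Finset.range (K + 1)).biUnion fun k => (Finset.Icc (-(K : ℤ)) K).biUnion fun j => B k j := by
    intro x hx
    simp only [Finset.mem_filter, Finset.mem_univ, true_and, BalancedAt, not_forall, not_le] at hx
    obtain ⟨k, hk, j, hj, h⟩ := hx
    simp only [Finset.mem_biUnion, Finset.mem_range, Finset.mem_Icc]
    refine ⟨k, by omega, j, abs_le.1 hj, ?_⟩
    simp only [B, Finset.mem_filter, Finset.mem_univ, true_and]
    exact h
  have hB : ∀ k ∈ Finset.range (K + 1), ∀ j ∈ Finset.Icc (-(K : ℤ)) K,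
      ((B k j).card : ℝ) ≤ 2 ^ N * (2 * Real.exp (-(E ^ 2 / (2 * K)))) := by
    intro k hk j hj
    rw [Finset.mem_range] at hk
    rw [Finset.mem_Icc] at hj
    have hlt : ∀ s < k, ((pos j s : ℕ) : ℤ) = (β : ℤ) - ((2 ^ (K + s) : ℕ) + j) ∧ pos j s < N := by
      intro s hs
      have : 2 ^ (K + s) ≤ 2 ^ (2 * K) := Nat.pow_le_pow_right (by norm_num) (by omega)
      have : 0 < 2 ^ (K + s) := by positivity
      simp only [hpos]
      omega
    have hN0 : 0 < N := by omega
    -- The default index is never used for `s < k`.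
    set ps : ℕ → Fin N := fun s => if h : pos j s < N then ⟨pos j s, h⟩ else ⟨0, hN0⟩ with hps
    have hpsv : ∀ s < k, ((ps s : Fin N) : ℕ) = pos j s := fun s hs => by
      rw [hps]; simp [(hlt s hs).2]
    have hinj : Set.InjOn ps (Finset.range k) := by
      intro s hs t ht hst
      simp only [Finset.coe_range, Set.mem_Iio] at hs ht
      have h1 : ((pos j s : ℕ) : ℤ) = pos j t := by rw [← hpsv s hs, ← hpsv t ht, hst]
      rw [(hlt s hs).1, (hlt t ht).1] at h1
      have h2 : 2 ^ (K + s) = 2 ^ (K + t) := by omega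
      have := Nat.pow_right_injective (le_refl 2) h2
      omega
    have hcard := card_lt_abs_sum_sign_le (K := K) (E := E) ((Finset.range k).image ps) hK
      (Finset.card_image_le.trans (by rw [Finset.card_range]; omega))
    rw [Fintype.card_fin] at hcard
    refine le_trans (le_of_eq ?_) hcard
    congr 2
    ext x
    simp only [B, Finset.mem_filter, Finset.mem_univ, true_and]
    rw [Finset.sum_image hinj]
    have : ∀ s ∈ Finset.range k, (if extendBits x (pos j s) then (1 : ℤ) else -1) =
        if x (ps s) then (1 : ℤ) else -1 := by
      intro s hs
      rw [Finset.mem_range] at hs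
      have : extendBits x (pos j s) = x (ps s) := by
        rw [extendBits, dif_pos (hlt s hs).2]
        congr 1
        exact Fin.ext (hpsv s hs).symm
      rw [this]
    rw [Finset.sum_congr rfl this]
  have h1 : (({x : Fin N → Bool | ¬ BalancedAt K E (extendBits x) β} : Finset _).card : ℝ) ≤
      ∑ k ∈ Finset.range (K + 1), ∑ j ∈ Finset.Icc (-(K : ℤ)) K, ((B k j).card : ℝ) := by
    have := (Finset.card_le_card hsub).trans (Finset.card_biUnion_le.trans
      (Finset.sum_le_sum fun k _ => Finset.card_biUnion_le))
    exact_mod_cast this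
  refine h1.trans ((Finset.sum_le_sum fun k hk => Finset.sum_le_sum fun j hj => hB k hk j hj).trans
    (le_of_eq ?_))
  simp only [Finset.sum_const, Finset.card_range, Int.card_Icc, nsmul_eq_mul]
  have : ((K : ℤ) + 1 - -(K : ℤ)).toNat = 2 * K + 1 := by omega
  rw [this]
  push_cast
  ring

/-! ### Codes -/

/-- Distinct indices have distinct triples, and a product of subprobability weights is a
subprobability weight on triples. -/
theorem sum_mul_mul_le_one {ι A B C : Type*} (s : Finset ι) (α : ι → A) (β : ι → B) (γ : ι → C)
    (hinj : ∀ i ∈ s, ∀ j ∈ s, α i = α j → β i = β j → γ i = γ j → i = j)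
    (f : A → ℝ) (g : B → ℝ) (h : C → ℝ) (f0 : ∀ a, 0 ≤ f a) (g0 : ∀ a, 0 ≤ g a) (h0 : ∀ a, 0 ≤ h a)
    (f1 : ∀ t : Finset A, ∑ a ∈ t, f a ≤ 1) (g1 : ∀ t : Finset B, ∑ a ∈ t, g a ≤ 1)
    (h1 : ∀ t : Finset C, ∑ a ∈ t, h a ≤ 1) :
    ∑ i ∈ s, f (α i) * g (β i) * h (γ i) ≤ 1 := by
  classical
  have e : ∑ i ∈ s, f (α i) * g (β i) * h (γ i) =
      ∑ p ∈ s.image fun i => (α i, β i, γ i), f p.1 * g p.2.1 * h p.2.2 := by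
    rw [Finset.sum_image]
    intro i hi j hj hij
    simp only [Prod.mk.injEq] at hij
    exact hinj i hi j hj hij.1 hij.2.1 hij.2.2
  rw [e]
  calc ∑ p ∈ s.image fun i => (α i, β i, γ i), f p.1 * g p.2.1 * h p.2.2
      ≤ ∑ p ∈ s.image α ×ˢ s.image β ×ˢ s.image γ, f p.1 * g p.2.1 * h p.2.2 := by
        refine Finset.sum_le_sum_of_subset_of_nonneg ?_ fun p _ _ =>
          mul_nonneg (mul_nonneg (f0 _) (g0 _)) (h0 _)
        intro p hp
        obtain ⟨i, hi, rfl⟩ := Finset.mem_image.1 hp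
        simp only [Finset.mem_product]
        exact ⟨Finset.mem_image_of_mem _ hi, Finset.mem_image_of_mem _ hi,
          Finset.mem_image_of_mem _ hi⟩
    _ = (∑ a ∈ s.image α, f a) * ((∑ b ∈ s.image β, g b) * ∑ c ∈ s.image γ, h c) := by
        rw [Finset.sum_product, Finset.sum_mul]
        refine Finset.sum_congr rfl fun a _ => ?_
        rw [Finset.sum_product, Finset.sum_mul_sum, Finset.mul_sum]
        refine Finset.sum_congr rfl fun b _ => ?_
        rw [Finset.mul_sum]
        refine Finset.sum_congr rfl fun c _ => by ring
    _ ≤ 1 := by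
        have := Finset.sum_nonneg fun a (_ : a ∈ s.image α) => f0 a
        have := Finset.sum_nonneg fun a (_ : a ∈ s.image β) => g0 a
        have := Finset.sum_nonneg fun a (_ : a ∈ s.image γ) => h0 a
        exact mul_le_one₀ (f1 _) (by positivity) (mul_le_one₀ (g1 _) (by positivity) (h1 _))

/-- A distribution on partial bit strings of length `m`. -/
noncomputable def partialBitsWeight (z : ℝ) {m : ℕ} (σ : Fin m → Option Bool) : ℝ :=
  ∏ s, (if (σ s).isSome then z else 1) / (1 + 2 * z)

theorem sum_partialBitsWeight_le {z : ℝ} (hz : 0 < z) {m : ℕ} (t : Finset (Fin m → Option Bool)) :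
    ∑ σ ∈ t, partialBitsWeight z σ ≤ 1 := by
  have h : ∑ σ : Fin m → Option Bool, partialBitsWeight z σ = 1 := by
    have h2 := Finset.prod_univ_sum (fun _ : Fin m => (Finset.univ : Finset (Option Bool)))
      fun _ o => (if o.isSome then z else 1) / (1 + 2 * z)
    rw [Fintype.piFinset_univ] at h2
    simp only [partialBitsWeight]
    rw [← h2, Finset.prod_const, ← Finset.sum_div, Fintype.sum_option, Fintype.sum_bool]
    simp only [Option.isSome_none, Option.isSome_some, Bool.false_eq_true, if_false, if_true]
    rw [show 1 + (z + z) = 1 + 2 * z by ring, div_self (by positivity), one_pow]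
  rw [← h]
  refine Finset.sum_le_sum_of_subset_of_nonneg (Finset.subset_univ _) fun σ _ _ =>
    Finset.prod_nonneg fun s _ => ?_
  split_ifs <;> positivity

theorem partialBitsWeight_eq (z : ℝ) {m : ℕ} (σ : Fin m → Option Bool) :
    partialBitsWeight z σ =
      z ^ (Finset.univ.filter fun s => (σ s).isSome).card / (1 + 2 * z) ^ m := by
  rw [partialBitsWeight, Finset.prod_div_distrib, Finset.prod_const, Finset.card_univ,
    Fintype.card_fin, Finset.prod_ite, Finset.prod_const_one, mul_one, Finset.prod_const]

/-! ### Information transfer -/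

namespace CellProbeAlgorithm

variable {w q : ℕ} {O : Type*}

/-- The cells accessed during the arrivals `S[t], …, S[t' - 1]`. -/
def accessedBetween (A : CellProbeAlgorithm w q O) (S : ℕ → Fin q) (t t' : ℕ) : Finset ℕ :=
  (Finset.Ico t t').biUnion fun s => (A.step s (S s)).accessed (A.memoryAfter S s)

/-- The cells accessed during the arrival of a block of length `r`. -/
def blockCells (A : CellProbeAlgorithm w q O) (S : ℕ → Fin q) (n r β : ℕ) : Finset ℕ :=
  A.accessedBetween S (2 * n + β * r) (2 * n + (β + 1) * r)

theorem biUnion_blockCells (A : CellProbeAlgorithm w q O) (S : ℕ → Fin q) (n : ℕ) {r : ℕ}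
    (hr : 0 < r) (a b : ℕ) :
    (Finset.Ico a b).biUnion (A.blockCells S n r) =
      A.accessedBetween S (2 * n + a * r) (2 * n + b * r) := by
  ext c
  simp only [blockCells, accessedBetween, Finset.mem_biUnion, Finset.mem_Ico]
  constructor
  · rintro ⟨β, ⟨h1, h2⟩, t, ⟨h3, h4⟩, h5⟩
    have h6 : a * r ≤ β * r := Nat.mul_le_mul_right _ h1
    have h7 : (β + 1) * r ≤ b * r := Nat.mul_le_mul_right _ h2
    exact ⟨t, ⟨by omega, by omega⟩, h5⟩
  · rintro ⟨t, ⟨h3, h4⟩, h5⟩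
    have h6 := Nat.div_mul_le_self (t - 2 * n) r
    have h7 := Nat.lt_div_mul_add (a := t - 2 * n) hr
    rw [← Nat.succ_mul, Nat.succ_eq_add_one] at h7
    refine ⟨(t - 2 * n) / r, ⟨?_, ?_⟩, t, ⟨by omega, by omega⟩, h5⟩
    · rw [Nat.le_div_iff_mul_le hr]; omega
    · rw [Nat.div_lt_iff_lt_mul hr]; omega

theorem sum_card_blockCells_le (A : CellProbeAlgorithm w q O) (S : ℕ → Fin q) (n r : ℕ) :
    ∑ β ∈ Finset.range (n / r), (A.blockCells S n r β).card ≤ A.totalTime n S := by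
  have h : ∀ R : ℕ, ∑ β ∈ Finset.range R, (A.blockCells S n r β).card ≤
      ∑ t ∈ Finset.range (R * r), A.timeAt S (2 * n + t) := by
    intro R
    induction R with
    | zero => simp
    | succ R ih =>
      rw [Finset.sum_range_succ, add_mul, one_mul, Finset.sum_range_add]
      refine Nat.add_le_add ih (Finset.card_biUnion_le.trans (le_of_eq ?_))
      rw [Finset.sum_Ico_eq_sum_range]
      refine Finset.sum_congr (by congr 1; rw [add_mul]; omega) fun t _ => ?_
      rw [timeAt, add_assoc]
  refine (h _).trans (Finset.sum_le_sum_of_subset ?_)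
  intro t ht
  rw [Finset.mem_range] at ht ⊢
  exact ht.trans_le (Nat.div_mul_le_self _ _)

end CellProbeAlgorithm

theorem hardStream_congr {q n r : ℕ} (hq : 4 ≤ q) {x x' : ℕ → Bool} {p : ℕ}
    (h : x ((p + 2 * n * (r - 1)) / r) = x' ((p + 2 * n * (r - 1)) / r)) :
    hardStream hq n r x p = hardStream hq n r x' p := by
  simp only [hardStream, streamLetter, h]

theorem zeroCount_eq_of_value_eq {n q K E τ : ℕ} {x x' : ℕ → Bool} (hq : 4 ≤ q) (P : StreamProblem)
    (hE : 1 ≤ E) (hN : 2 ^ (2 * K) ≤ n / (4 * E + 1)) (h : BalancedAt K E x (2 * n + τ))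
    (h' : BalancedAt K E x' (2 * n + τ))
    (hv : P.value (hardPattern hq K (4 * E + 1) n) (hardStream hq n (4 * E + 1) x)
      (2 * n + (τ + 1) * (4 * E + 1)) =
      P.value (hardPattern hq K (4 * E + 1) n) (hardStream hq n (4 * E + 1) x')
      (2 * n + (τ + 1) * (4 * E + 1))) :
    zeroCount K x (2 * n + τ) = zeroCount K x' (2 * n + τ) := by
  have h1 := value_hardPattern_hardStream hq P hE hN h
  have h2 := value_hardPattern_hardStream hq P hE hN h'
  rw [hv, h2] at h1
  cases P <;> dsimp only at h1 <;> omega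

/-- A count of zeros with all bits but one known reveals the remaining bit. -/
theorem eq_of_zeroCount_eq {K l β : ℕ} {x x' : ℕ → Bool} (hl : l < K)
    (hx : ∀ l' < K, l' ≠ l → x (β - 2 ^ (K + l')) = x' (β - 2 ^ (K + l')))
    (h : zeroCount K x β = zeroCount K x' β) : x (β - 2 ^ (K + l)) = x' (β - 2 ^ (K + l)) := by
  rw [zeroCount, zeroCount, Finset.card_filter, Finset.card_filter,
    ← Finset.add_sum_erase _ _ (Finset.mem_range.2 hl),
    ← Finset.add_sum_erase _ _ (Finset.mem_range.2 hl)] at h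
  have e : ∑ l' ∈ (Finset.range K).erase l, (if x (β - 2 ^ (K + l')) = false then 1 else 0) =
      ∑ l' ∈ (Finset.range K).erase l, (if x' (β - 2 ^ (K + l')) = false then 1 else 0) := by
    refine Finset.sum_congr rfl fun l' hl' => ?_
    rw [Finset.mem_erase, Finset.mem_range] at hl'
    rw [hx l' hl'.2 hl'.1]
  rw [e] at h
  have h := Nat.add_right_cancel h
  revert h
  cases x (β - 2 ^ (K + l)) <;> cases x' (β - 2 ^ (K + l)) <;> simp

/-! ### Encoding the first half of a dyadic interval -/

section Node

variable {n q K E : ℕ} {O : Type*} (hq : 4 ≤ q) (P : StreamProblem) (dec : ℕ → O → ℕ)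
  (A : CellProbeAlgorithm 1 q O)

open Classical in
/-- The unknown bits at those of the blocks `v, …, v + m - 1` that are not balanced. -/
noncomputable def unbalancedBits (K E u v m : ℕ) (x : ℕ → Bool) (s : Fin m) : Option Bool :=
  if BalancedAt K E x (v + s) then none else some (x (u + s))

/-- The outputs during the second half of a dyadic interval determine the data bits of the first. -/
theorem eq_of_outputs_eq (hE : 1 ≤ E) (hN : 2 ^ (2 * K) ≤ n / (4 * E + 1)) {i k : ℕ}
    (hKi : K ≤ i) (hi : i < 2 * K) (hk : (2 * k + 2) * 2 ^ i ≤ n / (4 * E + 1)) {x x' : ℕ → Bool}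
    (hcorr : A.CorrectOn P dec (hardPattern hq K (4 * E + 1) n) (hardStream hq n (4 * E + 1) x))
    (hcorr' : A.CorrectOn P dec (hardPattern hq K (4 * E + 1) n) (hardStream hq n (4 * E + 1) x'))
    (hx : ∀ p, ¬ (2 * n + 2 * k * 2 ^ i ≤ p ∧ p < 2 * n + (2 * k + 1) * 2 ^ i) → x p = x' p)
    (hY : P.value (hardPattern hq K (4 * E + 1) n) (hardStream hq n (4 * E + 1) x)
      (2 * n + (2 * k + 1) * 2 ^ i * (4 * E + 1)) =
      P.value (hardPattern hq K (4 * E + 1) n) (hardStream hq n (4 * E + 1) x')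
      (2 * n + (2 * k + 1) * 2 ^ i * (4 * E + 1)))
    (hO : ∀ s < 2 ^ i * (4 * E + 1), A.outputAt (hardStream hq n (4 * E + 1) x)
      (2 * n + (2 * k + 1) * 2 ^ i * (4 * E + 1) + s) = A.outputAt (hardStream hq n (4 * E + 1) x')
      (2 * n + (2 * k + 1) * 2 ^ i * (4 * E + 1) + s))
    (hB : unbalancedBits K E (2 * n + 2 * k * 2 ^ i) (2 * n + (2 * k + 1) * 2 ^ i) (2 ^ i) x =
      unbalancedBits K E (2 * n + 2 * k * 2 ^ i) (2 * n + (2 * k + 1) * 2 ^ i) (2 ^ i) x') :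
    x = x' := by
  set r := 4 * E + 1 with hr
  set m := 2 ^ i with hm
  have hm0 : 0 < m := by positivity
  have hnr : n / r * r ≤ n := Nat.div_mul_le_self _ _
  have hnr' : n / r ≤ n := Nat.div_le_self _ _
  have e1 : (2 * k + 1) * m = 2 * k * m + m := by ring
  have e2 : (2 * k + 2) * m = 2 * k * m + m + m := by ring
  have hend : (2 * k + 1) * m * r + m * r ≤ n := by
    refine le_trans ?_ ((Nat.mul_le_mul_right r hk).trans hnr)
    exact le_of_eq (by ring)
  -- Outputs are decoded relative to the preceding value, so the value at the midpoint starts an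
  -- induction that yields all values of the second half.
  have hval : ∀ s ≤ m * r, P.value (hardPattern hq K r n) (hardStream hq n r x)
      (2 * n + (2 * k + 1) * m * r + s) = P.value (hardPattern hq K r n) (hardStream hq n r x')
      (2 * n + (2 * k + 1) * m * r + s) := by
    intro s
    induction s with
    | zero => intro _; exact hY
    | succ s ih =>
      intro hs
      have h1 := hcorr ((2 * k + 1) * m * r + s) (by omega)
      have h2 := hcorr' ((2 * k + 1) * m * r + s) (by omega)
      have h3 := hO s (by omega)
      have h4 := ih (by omega)
      rw [add_assoc] at h3 h4
      rw [h3, h4, h2] at h1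
      rw [← add_assoc, add_assoc (2 * n)]
      exact h1.symm
  -- The bits are recovered from the last to the first, `d` being the number of those already known.
  -- After block `s` of the second half, distance `2 ^ i` points to bit `s` of the first half.
  -- Smaller distances point to the second half or to later bits of the first; larger ones are at
  -- least `2 * 2 ^ i` and point before the interval.
  have main : ∀ d s, s + d + 1 = m → x (2 * n + 2 * k * m + s) = x' (2 * n + 2 * k * m + s) := by
    intro d
    induction d using Nat.strong_induction_on with
    | _ d ih =>
      intro s hs
      have hBs := congrFun hB ⟨s, by omega⟩
      simp only [unbalancedBits] at hBs
      by_cases h1 : BalancedAt K E x (2 * n + (2 * k + 1) * m + s)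
      · by_cases h2 : BalancedAt K E x' (2 * n + (2 * k + 1) * m + s)
        · rw [add_assoc] at h1 h2
          have hsr : (s + 1) * r ≤ m * r := Nat.mul_le_mul_right _ (by omega)
          have h3 := hval ((s + 1) * r) hsr
          have e3 : 2 * n + (2 * k + 1) * m * r + (s + 1) * r =
              2 * n + ((2 * k + 1) * m + s + 1) * r := by ring
          rw [e3] at h3
          have h4 := zeroCount_eq_of_value_eq hq P hE hN h1 h2 h3
          have h5 := eq_of_zeroCount_eq (l := i - K) (by omega) (fun l' hl' hne => ?_) h4
          · rw [show K + (i - K) = i by omega, ← hm,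
              show 2 * n + ((2 * k + 1) * m + s) - m = 2 * n + 2 * k * m + s by omega] at h5
            exact h5
          · have hp : 2 ^ (K + l') ≤ 2 ^ (2 * K) := Nat.pow_le_pow_right (by norm_num) (by omega)
            rcases Nat.lt_or_ge (K + l') i with hlt | hge
            · have hpm : 2 ^ (K + l') < m := Nat.pow_lt_pow_right (by norm_num) hlt
              by_cases hin : m + s - 2 ^ (K + l') < m
              · have := ih (m - 1 - (m + s - 2 ^ (K + l'))) (by omega) (m + s - 2 ^ (K + l'))
                  (by omega)
                rw [show 2 * n + ((2 * k + 1) * m + s) - 2 ^ (K + l') =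
                  2 * n + 2 * k * m + (m + s - 2 ^ (K + l')) by omega]
                exact this
              · exact hx _ (by omega)
            · have : 2 ^ (i + 1) ≤ 2 ^ (K + l') :=
                Nat.pow_le_pow_right (by norm_num) (by omega)
              rw [pow_succ, ← hm] at this
              exact hx _ (by omega)
        · rw [if_pos h1, if_neg h2] at hBs
          cases hBs
      · by_cases h2 : BalancedAt K E x' (2 * n + (2 * k + 1) * m + s)
        · rw [if_neg h1, if_pos h2] at hBs
          cases hBs
        · rw [if_neg h1, if_neg h2] at hBs
          exact Option.some.inj hBs
  funext p
  by_cases hp : 2 * n + 2 * k * m ≤ p ∧ p < 2 * n + (2 * k + 1) * m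
  · have := main (m - 1 - (p - (2 * n + 2 * k * m))) (p - (2 * n + 2 * k * m)) (by omega)
    rwa [show 2 * n + 2 * k * m + (p - (2 * n + 2 * k * m)) = p by omega] at this
  · exact hx p hp

theorem extendBits_injective (N : ℕ) : Function.Injective (extendBits (N := N)) := by
  intro x x' h
  funext i
  have := congrFun h i
  simpa [extendBits] using this

/-- The weight of the code of a hard stream for a dyadic interval. -/
noncomputable def codeWeight (n r : ℕ) (K E : ℕ) (A : CellProbeAlgorithm 1 q O) (z : ℝ) (i k : ℕ)
    (x : ℕ → Bool) : ℝ :=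
  z ^ ((Finset.Ico ((2 * k + 1) * 2 ^ i) ((2 * k + 2) * 2 ^ i)).biUnion
      (A.blockCells (hardStream hq n r x) n r) ∩
      (Finset.Ico (2 * k * 2 ^ i) ((2 * k + 1) * 2 ^ i)).biUnion
      (A.blockCells (hardStream hq n r x) n r)).card /
    (1 + 2 * z) ^ ((Finset.Ico ((2 * k + 1) * 2 ^ i) ((2 * k + 2) * 2 ^ i)).biUnion
      (A.blockCells (hardStream hq n r x) n r)).card *
    partialBitsWeight (1 / 16)
      (unbalancedBits K E (2 * n + 2 * k * 2 ^ i) (2 * n + (2 * k + 1) * 2 ^ i) (2 ^ i) x) *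
    (1 / (n + 1))

open Classical in
/-- Kraft's inequality for the hard streams with given data bits outside of the first half of a dyadic
interval. -/
theorem sum_codeWeight_le_one (hE : 1 ≤ E) (hN : 2 ^ (2 * K) ≤ n / (4 * E + 1)) {i k : ℕ}
    (hKi : K ≤ i) (hi : i < 2 * K) (hk : (2 * k + 2) * 2 ^ i ≤ n / (4 * E + 1))
    {z : ℝ} (hz0 : 0 < z) (hz1 : z ≤ 1) {N : ℕ} (T : Finset (Fin N → Bool))
    (hcorr : ∀ x ∈ T, A.CorrectOn P dec (hardPattern hq K (4 * E + 1) n)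
      (hardStream hq n (4 * E + 1) (extendBits x)))
    (hT : ∀ x ∈ T, ∀ x' ∈ T, ∀ p,
      ¬ (2 * n + 2 * k * 2 ^ i ≤ p ∧ p < 2 * n + (2 * k + 1) * 2 ^ i) →
      extendBits x p = extendBits x' p) :
    ∑ x ∈ T, codeWeight hq n (4 * E + 1) K E A z i k (extendBits x) ≤ 1 := by
  rcases T.eq_empty_or_nonempty with rfl | ⟨y, hy⟩
  · simp
  set r := 4 * E + 1 with hr
  have hr0 : 0 < r := by omega
  set m := 2 ^ i with hm
  have hm0 : 0 < m := by positivity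
  have hnr' : n / r ≤ n := Nat.div_le_self _ _
  have hn0 : 0 < n := by
    have : 0 < 2 ^ (2 * K) := by positivity
    omega
  set S : (Fin N → Bool) → ℕ → Fin q := fun x => hardStream hq n r (extendBits x) with hS
  have hbefore : ∀ x ∈ T, ∀ t < 2 * n + 2 * k * m * r, S x t = S y t := by
    intro x hx t ht
    refine hardStream_congr hq (hT x hx y hy _ ?_)
    have : (t + 2 * n * (r - 1)) / r < 2 * n + 2 * k * m := by
      rw [Nat.div_lt_iff_lt_mul hr0, add_mul, hr, add_tsub_cancel_right]
      rw [hr] at ht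
      have : 2 * n * (4 * E + 1) = 2 * n * (4 * E) + 2 * n := by ring
      omega
    omega
  have hafter : ∀ x ∈ T, ∀ t, 2 * n + (2 * k + 1) * m * r ≤ t → S x t = S y t := by
    intro x hx t ht
    refine hardStream_congr hq (hT x hx y hy _ ?_)
    have : 2 * n + (2 * k + 1) * m ≤ (t + 2 * n * (r - 1)) / r := by
      rw [Nat.le_div_iff_mul_le hr0, add_mul, hr, add_tsub_cancel_right]
      rw [hr] at ht
      have : 2 * n * (4 * E + 1) = 2 * n * (4 * E) + 2 * n := by ring
      omega
    omega
  have hmr : 2 * n + 2 * k * m * r + m * r = 2 * n + (2 * k + 1) * m * r := by ring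
  have hmr' : 2 * n + (2 * k + 1) * m * r + m * r = 2 * n + (2 * k + 2) * m * r := by ring
  -- All streams in `T` share the memory before the first half and the program of the second half.
  -- At the midpoint the memories differ from the former only in cells accessed during the first
  -- half, which form the set `W`.
  obtain ⟨f, f0, f1, f2⟩ := Program.exists_weight z hz0 hz1
    (A.run (S y) (2 * n + (2 * k + 1) * m * r) (m * r))
    (A.memoryAfter (S y) (2 * n + 2 * k * m * r)) ∅
  set out : (Fin N → Bool) → List O := fun x =>
    (List.range (m * r)).map fun s => A.outputAt (S x) (2 * n + (2 * k + 1) * m * r + s) with hout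
  set h : ℕ → ℝ := fun y => if y ≤ n then 1 / ((n : ℝ) + 1) else 0 with hh
  set val : (Fin N → Bool) → ℕ := fun x => P.value (hardPattern hq K r n) (S x)
    (2 * n + (2 * k + 1) * m * r) with hval
  set bits : (Fin N → Bool) → Fin m → Option Bool := fun x =>
    unbalancedBits K E (2 * n + 2 * k * m) (2 * n + (2 * k + 1) * m) m (extendBits x) with hbits
  have hrun : ∀ x ∈ T, A.run (S y) (2 * n + (2 * k + 1) * m * r) (m * r) =
      A.run (S x) (2 * n + (2 * k + 1) * m * r) (m * r) := fun x hx =>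
    A.run_congr _ _ fun s h1 _ => (hafter x hx s h1).symm
  have hle : ∀ x ∈ T, codeWeight hq n r K E A z i k (extendBits x) ≤
      f (out x) * partialBitsWeight (1 / 16) (bits x) * h (val x) := by
    intro x hx
    have hv : val x ≤ n := StreamProblem.value_le _ _ _ hn0 (by omega)
    simp only [codeWeight, hh, if_pos hv]
    rw [← hm]
    have hpb : 0 ≤ partialBitsWeight (1 / 16) (bits x) := by
      rw [partialBitsWeight_eq]; positivity
    refine mul_le_mul_of_nonneg_right (mul_le_mul_of_nonneg_right ?_ hpb) (by positivity)
    rw [div_le_iff₀ (by positivity), A.biUnion_blockCells _ _ hr0, A.biUnion_blockCells _ _ hr0]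
    have h1 := f2 (A.memoryAfter (S x) (2 * n + (2 * k + 1) * m * r))
      (A.accessedBetween (S x) (2 * n + 2 * k * m * r) (2 * n + (2 * k + 1) * m * r))
      (fun a ha => by
        rw [← hmr] at ha ⊢
        rw [A.memoryAfter_add_of_notMem _ _ _ _ ha,
          A.memoryAfter_congr _ (hbefore x hx)]) (by simp)
    rw [hrun x hx, A.run_result, A.run_accessed, Finset.sdiff_empty, hmr'] at h1
    exact h1
  refine (Finset.sum_le_sum hle).trans ?_
  refine sum_mul_mul_le_one T out bits val ?_ f (partialBitsWeight (1 / 16)) h f0 ?_ ?_ f1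
    (fun t => sum_partialBitsWeight_le (by norm_num) t) ?_
  · intro x hx x' hx' h1 h2 h3
    refine extendBits_injective N (eq_of_outputs_eq hq P dec A hE hN hKi hi hk (hcorr x hx)
      (hcorr x' hx') (hT x hx x' hx') h3 (fun s hs => ?_) h2)
    exact List.map_inj_left.1 h1 s (List.mem_range.2 hs)
  · intro σ
    rw [partialBitsWeight_eq]; positivity
  · intro a
    simp only [hh]
    split_ifs <;> positivity
  · intro t
    simp only [hh]
    rw [← Finset.sum_filter, Finset.sum_const, nsmul_eq_mul, mul_one_div, div_le_one (by positivity)]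
    have : (t.filter fun a => a ≤ n) ⊆ Finset.range (n + 1) := by
      intro a ha
      rw [Finset.mem_filter] at ha
      rw [Finset.mem_range]; omega
    have := Finset.card_le_card this
    rw [Finset.card_range] at this
    exact_mod_cast this

-- There are at most `2 ^ (4 * n - 2 ^ i)` ways to fix the bits outside the first half, and for each
-- of them Kraft's inequality holds.
open Classical in
theorem sum_codeWeight_le (hE : 1 ≤ E) (hN : 2 ^ (2 * K) ≤ n / (4 * E + 1)) {i k : ℕ}
    (hKi : K ≤ i) (hi : i < 2 * K) (hk : (2 * k + 2) * 2 ^ i ≤ n / (4 * E + 1))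
    {z : ℝ} (hz0 : 0 < z) (hz1 : z ≤ 1)
    (hcorr : ∀ x : Fin (4 * n) → Bool, A.CorrectOn P dec (hardPattern hq K (4 * E + 1) n)
      (hardStream hq n (4 * E + 1) (extendBits x))) :
    2 ^ 2 ^ i * ∑ x : Fin (4 * n) → Bool,
      codeWeight hq n (4 * E + 1) K E A z i k (extendBits x) ≤ 2 ^ (4 * n) := by
  set U : Fin (4 * n) → Prop := fun p =>
    2 * n + 2 * k * 2 ^ i ≤ p ∧ (p : ℕ) < 2 * n + (2 * k + 1) * 2 ^ i with hU
  set ρ : (Fin (4 * n) → Bool) → ({p : Fin (4 * n) // ¬ U p} → Bool) := fun x p => x p with hρ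
  have e1 : (2 * k + 1) * 2 ^ i = 2 * k * 2 ^ i + 2 ^ i := by ring
  have e2 : (2 * k + 2) * 2 ^ i = 2 * k * 2 ^ i + 2 ^ i + 2 ^ i := by ring
  have hnr' : n / (4 * E + 1) ≤ n := Nat.div_le_self _ _
  have hcard : 2 ^ i ≤ Fintype.card {p : Fin (4 * n) // U p} := by
    refine (Fintype.card_fin (2 ^ i)).symm.trans_le (Fintype.card_le_of_injective (fun s : Fin (2 ^ i) =>
      (⟨⟨2 * n + 2 * k * 2 ^ i + s, by omega⟩, by simp only [hU]; omega⟩ :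
        {p : Fin (4 * n) // U p})) ?_)
    intro s t hst
    simp only [Subtype.mk.injEq, Fin.mk.injEq] at hst
    exact Fin.ext (by omega)
  have hc2 : Fintype.card {p : Fin (4 * n) // ¬ U p} + 2 ^ i ≤ 4 * n := by
    have h1 := Fintype.card_subtype_compl U
    have h2 := Fintype.card_subtype_le U
    rw [Fintype.card_fin] at h1 h2
    omega
  rw [← Finset.sum_fiberwise (s := Finset.univ) (g := ρ)]
  have hfib : ∀ c, ∑ x ∈ Finset.univ.filter (fun x => ρ x = c),
      codeWeight hq n (4 * E + 1) K E A z i k (extendBits x) ≤ 1 := by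
    intro c
    refine sum_codeWeight_le_one hq P dec A hE hN hKi hi hk hz0 hz1 _ (fun x _ => hcorr x) ?_
    intro x hx x' hx' p hp
    rw [Finset.mem_filter] at hx hx'
    simp only [extendBits]
    split_ifs with h
    · exact congrFun (hx.2.trans hx'.2.symm) ⟨⟨p, h⟩, hp⟩
    · rfl
  calc (2 : ℝ) ^ 2 ^ i * ∑ c, ∑ x ∈ Finset.univ.filter (fun x => ρ x = c),
        codeWeight hq n (4 * E + 1) K E A z i k (extendBits x)
      ≤ 2 ^ 2 ^ i * ∑ c : {p : Fin (4 * n) // ¬ U p} → Bool, 1 := by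
        gcongr with c
        exact hfib c
    _ = 2 ^ (2 ^ i + Fintype.card {p : Fin (4 * n) // ¬ U p}) := by
        simp [pow_add]
    _ ≤ 2 ^ (4 * n) := pow_le_pow_right₀ (by norm_num) (by omega)

open Classical in
/-- The average information that is transferred from the first half of a dyadic interval to the
second. -/
theorem information_transfer (hE : 1 ≤ E) (hN : 2 ^ (2 * K) ≤ n / (4 * E + 1)) {i k : ℕ}
    (hKi : K ≤ i) (hi : i < 2 * K) (hk : (2 * k + 2) * 2 ^ i ≤ n / (4 * E + 1))
    {z : ℝ} (hz0 : 0 < z) (hz1 : z ≤ 1)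
    (hcorr : ∀ x : Fin (4 * n) → Bool, A.CorrectOn P dec (hardPattern hq K (4 * E + 1) n)
      (hardStream hq n (4 * E + 1) (extendBits x))) :
    2 ^ (4 * n) * (2 ^ i * (Real.log 2 - 1 / 8) - Real.log (n + 1)) ≤
      ∑ x : Fin (4 * n) → Bool,
        (((((Finset.Ico ((2 * k + 1) * 2 ^ i) ((2 * k + 2) * 2 ^ i)).biUnion
          (A.blockCells (hardStream hq n (4 * E + 1) (extendBits x)) n (4 * E + 1))) ∩
          ((Finset.Ico (2 * k * 2 ^ i) ((2 * k + 1) * 2 ^ i)).biUnion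
          (A.blockCells (hardStream hq n (4 * E + 1) (extendBits x)) n (4 * E + 1)))).card : ℝ) *
            -Real.log z +
          (∑ β ∈ Finset.Ico ((2 * k + 1) * 2 ^ i) ((2 * k + 2) * 2 ^ i),
            (A.blockCells (hardStream hq n (4 * E + 1) (extendBits x)) n (4 * E + 1) β).card : ℕ) *
            (2 * z) +
          (∑ β ∈ Finset.Ico ((2 * k + 1) * 2 ^ i) ((2 * k + 2) * 2 ^ i),
            if BalancedAt K E (extendBits x) (2 * n + β) then 0 else 1 : ℕ) * Real.log 16) := by
  have hsum := sum_codeWeight_le hq P dec A hE hN hKi hi hk hz0 hz1 hcorr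
  set m := 2 ^ i with hm
  have hterm : ∀ x : Fin (4 * n) → Bool,
      1 + m * Real.log 2 + Real.log (codeWeight hq n (4 * E + 1) K E A z i k (extendBits x)) ≤
        2 ^ m * codeWeight hq n (4 * E + 1) K E A z i k (extendBits x) := by
    intro x
    have hpos : 0 < codeWeight hq n (4 * E + 1) K E A z i k (extendBits x) := by
      rw [codeWeight, partialBitsWeight_eq]; positivity
    -- The inequality `log t ≤ t - 1` at `t = 2 ^ m * codeWeight` plays the role of Jensen's
    -- inequality.
    have h1 := Real.log_le_sub_one_of_pos (mul_pos (show (0 : ℝ) < 2 ^ m by positivity) hpos)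
    rw [Real.log_mul (by positivity) hpos.ne', Real.log_pow] at h1
    linarith
  have h2 := (Finset.sum_le_sum fun x (_ : x ∈ Finset.univ) => hterm x).trans
    ((Finset.mul_sum _ _ _).symm.trans_le hsum)
  have hlog : ∀ x : Fin (4 * n) → Bool,
      -Real.log (codeWeight hq n (4 * E + 1) K E A z i k (extendBits x)) ≤
        ((((Finset.Ico ((2 * k + 1) * m) ((2 * k + 2) * m)).biUnion
          (A.blockCells (hardStream hq n (4 * E + 1) (extendBits x)) n (4 * E + 1))) ∩
          ((Finset.Ico (2 * k * m) ((2 * k + 1) * m)).biUnion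
          (A.blockCells (hardStream hq n (4 * E + 1) (extendBits x)) n (4 * E + 1)))).card : ℝ) *
            -Real.log z +
          (∑ β ∈ Finset.Ico ((2 * k + 1) * m) ((2 * k + 2) * m),
            (A.blockCells (hardStream hq n (4 * E + 1) (extendBits x)) n (4 * E + 1) β).card : ℕ) *
            (2 * z) +
          (∑ β ∈ Finset.Ico ((2 * k + 1) * m) ((2 * k + 2) * m),
            if BalancedAt K E (extendBits x) (2 * n + β) then 0 else 1 : ℕ) * Real.log 16 +
          m * (1 / 8) + Real.log (n + 1) := by
    intro x
    have hbad : (Finset.univ.filter fun s => (unbalancedBits K E (2 * n + 2 * k * m)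
        (2 * n + (2 * k + 1) * m) m (extendBits x) s).isSome).card =
        ∑ β ∈ Finset.Ico ((2 * k + 1) * m) ((2 * k + 2) * m),
          if BalancedAt K E (extendBits x) (2 * n + β) then 0 else 1 := by
      rw [Finset.sum_Ico_eq_sum_range,
        show (2 * k + 2) * m - (2 * k + 1) * m = m by rw [← Nat.sub_mul]; simp,
        Finset.sum_range, Finset.card_filter]
      refine Finset.sum_congr rfl fun s _ => ?_
      simp only [unbalancedBits, ← add_assoc]
      by_cases h : BalancedAt K E (extendBits x) (2 * n + (2 * k + 1) * m + s) <;> simp [h]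
    rw [codeWeight, partialBitsWeight_eq, ← hm, hbad]
    set a := (((Finset.Ico ((2 * k + 1) * m) ((2 * k + 2) * m)).biUnion
          (A.blockCells (hardStream hq n (4 * E + 1) (extendBits x)) n (4 * E + 1))) ∩
          ((Finset.Ico (2 * k * m) ((2 * k + 1) * m)).biUnion
          (A.blockCells (hardStream hq n (4 * E + 1) (extendBits x)) n (4 * E + 1)))).card
    set b := ∑ β ∈ Finset.Ico ((2 * k + 1) * m) ((2 * k + 2) * m),
          if BalancedAt K E (extendBits x) (2 * n + β) then 0 else 1
    have hc : ((Finset.Ico ((2 * k + 1) * m) ((2 * k + 2) * m)).biUnion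
          (A.blockCells (hardStream hq n (4 * E + 1) (extendBits x)) n (4 * E + 1))).card ≤
          ∑ β ∈ Finset.Ico ((2 * k + 1) * m) ((2 * k + 2) * m),
            (A.blockCells (hardStream hq n (4 * E + 1) (extendBits x)) n (4 * E + 1) β).card :=
      Finset.card_biUnion_le
    set c := ((Finset.Ico ((2 * k + 1) * m) ((2 * k + 2) * m)).biUnion
          (A.blockCells (hardStream hq n (4 * E + 1) (extendBits x)) n (4 * E + 1))).card
    set c' := ∑ β ∈ Finset.Ico ((2 * k + 1) * m) ((2 * k + 2) * m),
            (A.blockCells (hardStream hq n (4 * E + 1) (extendBits x)) n (4 * E + 1) β).card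
    rw [Real.log_mul (by positivity) (by positivity), Real.log_mul (by positivity) (by positivity),
      Real.log_div (by positivity) (by positivity), Real.log_div (by positivity) (by positivity),
      Real.log_pow, Real.log_pow, Real.log_pow, Real.log_pow, one_div, one_div, Real.log_inv,
      Real.log_inv]
    have l1 : Real.log (1 + 2 * z) ≤ 2 * z := by
      have := Real.log_le_sub_one_of_pos (show 0 < 1 + 2 * z by positivity)
      linarith
    -- The weight `1 / 16` makes an unbalanced block cost `log 16` and adds at most `1 / 8` for
    -- every block, below the gain of `log 2`.
    have l2 : Real.log (1 + 2 * (16 : ℝ)⁻¹) ≤ 1 / 8 := by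
      have := Real.log_le_sub_one_of_pos (show (0 : ℝ) < 1 + 2 * 16⁻¹ by positivity)
      linarith
    have l3 : (c : ℝ) * Real.log (1 + 2 * z) ≤ c' * (2 * z) := by
      have : (c : ℝ) ≤ c' := by exact_mod_cast hc
      calc (c : ℝ) * Real.log (1 + 2 * z) ≤ c * (2 * z) := by gcongr
        _ ≤ c' * (2 * z) := by gcongr
    have l4 : (m : ℝ) * Real.log (1 + 2 * (16 : ℝ)⁻¹) ≤ m * (1 / 8) := by gcongr
    linarith
  have h3 := Finset.sum_le_sum fun x (_ : x ∈ Finset.univ) => hlog x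
  rw [Finset.sum_add_distrib, Finset.sum_const, Finset.card_univ] at h2
  rw [Finset.sum_neg_distrib, Finset.sum_add_distrib, Finset.sum_add_distrib, Finset.sum_const,
    Finset.sum_const, Finset.card_univ] at h3
  simp only [Fintype.card_fun, Fintype.card_bool, Fintype.card_fin, nsmul_eq_mul] at h2 h3
  have hmc : (m : ℝ) = 2 ^ i := by rw [hm]; push_cast; rfl
  rw [← hmc]
  push_cast at h2 h3 ⊢
  linarith

end Node

/-! ### The lower bound -/

/-- The right halves of the dyadic intervals of one length are disjoint. -/
theorem sum_dyadic_le (g : ℕ → ℕ) (R i : ℕ) :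
    ∑ k ∈ Finset.range (R / 2 ^ (i + 1)),
      ∑ β ∈ Finset.Ico ((2 * k + 1) * 2 ^ i) ((2 * k + 2) * 2 ^ i), g β ≤
      ∑ β ∈ Finset.range R, g β := by
  have h : ∀ ν : ℕ, ∑ k ∈ Finset.range ν,
      ∑ β ∈ Finset.Ico ((2 * k + 1) * 2 ^ i) ((2 * k + 2) * 2 ^ i), g β ≤
      ∑ β ∈ Finset.range (ν * 2 ^ (i + 1)), g β := by
    intro ν
    induction ν with
    | zero => simp
    | succ ν ih =>
      have e1 : ν * 2 ^ (i + 1) = 2 * ν * 2 ^ i := by ring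
      have e2 : (ν + 1) * 2 ^ (i + 1) = (2 * ν + 2) * 2 ^ i := by ring
      rw [Finset.sum_range_succ, ← Finset.sum_range_add_sum_Ico g
        (show ν * 2 ^ (i + 1) ≤ (ν + 1) * 2 ^ (i + 1) from Nat.mul_le_mul_right _ (by omega))]
      refine Nat.add_le_add ih (Finset.sum_le_sum_of_subset (Finset.Ico_subset_Ico ?_ e2.ge))
      rw [e1]
      exact Nat.mul_le_mul_right _ (by omega)
  refine (h _).trans (Finset.sum_le_sum_of_subset ?_)
  intro t ht
  rw [Finset.mem_range] at ht ⊢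
  exact ht.trans_le (Nat.div_mul_le_self _ _)

section Average

variable {n q K E : ℕ} {O : Type*} (hq : 4 ≤ q) (P : StreamProblem) (dec : ℕ → O → ℕ)
  (A : CellProbeAlgorithm 1 q O)

open Classical in
theorem sum_not_balancedAt_le (hK : 0 < K) (hN : 2 ^ (2 * K) ≤ n / (4 * E + 1))
    (hbad : ((K : ℝ) + 1) * (2 * K + 1) * (2 * Real.exp (-(E ^ 2 / (2 * K)))) ≤ 1 / 100) :
    ∑ x : Fin (4 * n) → Bool, ((∑ β ∈ Finset.range (n / (4 * E + 1)),
      if BalancedAt K E (extendBits x) (2 * n + β) then 0 else 1 : ℕ) : ℝ) ≤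
      2 ^ (4 * n) * ((n / (4 * E + 1) : ℕ) / 100) := by
  have hKn : K < 2 ^ (2 * K) := lt_of_lt_of_le Nat.lt_two_pow_self
    (Nat.pow_le_pow_right (by norm_num) (by omega))
  have hnr : n / (4 * E + 1) ≤ n := Nat.div_le_self _ _
  push_cast
  rw [Finset.sum_comm]
  have h : ∀ β ∈ Finset.range (n / (4 * E + 1)), ∑ x : Fin (4 * n) → Bool,
      (if BalancedAt K E (extendBits x) (2 * n + β) then (0 : ℝ) else 1) ≤
        2 ^ (4 * n) * (1 / 100) := by
    intro β hβ
    rw [Finset.mem_range] at hβ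
    have h1 := card_not_balancedAt_le (K := K) (E := E) (N := 4 * n) (β := 2 * n + β) hK
      (by omega) (by omega)
    have h2 : ∑ x : Fin (4 * n) → Bool,
        (if BalancedAt K E (extendBits x) (2 * n + β) then (0 : ℝ) else 1) =
        ({x : Fin (4 * n) → Bool | ¬ BalancedAt K E (extendBits x) (2 * n + β)} : Finset _).card := by
      rw [Finset.card_filter]
      push_cast
      refine Finset.sum_congr rfl fun x _ => ?_
      by_cases h : BalancedAt K E (extendBits x) (2 * n + β) <;> simp [h]
    rw [h2]
    refine h1.trans ?_
    gcongr
  refine (Finset.sum_le_sum h).trans (le_of_eq ?_)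
  rw [Finset.sum_const, Finset.card_range, nsmul_eq_mul]
  ring

open Classical in
/-- The contribution of the dyadic intervals of one length. -/
theorem level_bound (hE : 1 ≤ E) (hK : 0 < K) (hN : 2 ^ (2 * K) ≤ n / (4 * E + 1))
    (hbad : ((K : ℝ) + 1) * (2 * K + 1) * (2 * Real.exp (-(E ^ 2 / (2 * K)))) ≤ 1 / 100)
    (hlog : Real.log (n + 1) ≤ 2 ^ K / 8) {i : ℕ} (hKi : K ≤ i) (hi : i < 2 * K)
    (hcorr : ∀ x : Fin (4 * n) → Bool, A.CorrectOn P dec (hardPattern hq K (4 * E + 1) n)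
      (hardStream hq n (4 * E + 1) (extendBits x))) :
    2 ^ (4 * n) * ((n / (4 * E + 1) : ℕ) * (2 / 25)) ≤
      ∑ x : Fin (4 * n) → Bool,
        (((∑ k ∈ Finset.range (n / (4 * E + 1) / 2 ^ (i + 1)),
          (((Finset.Ico ((2 * k + 1) * 2 ^ i) ((2 * k + 2) * 2 ^ i)).biUnion
          (A.blockCells (hardStream hq n (4 * E + 1) (extendBits x)) n (4 * E + 1))) ∩
          ((Finset.Ico (2 * k * 2 ^ i) ((2 * k + 1) * 2 ^ i)).biUnion
          (A.blockCells (hardStream hq n (4 * E + 1) (extendBits x)) n (4 * E + 1)))).card : ℕ) : ℝ) *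
            Real.log K +
          (A.totalTime n (hardStream hq n (4 * E + 1) (extendBits x)) : ℝ) * (2 / K)) := by
  have hbad' := sum_not_balancedAt_le hK hN hbad
  set R := n / (4 * E + 1) with hR
  set ν := R / 2 ^ (i + 1) with hν
  have hK0 : (0 : ℝ) < K := by exact_mod_cast hK
  have hK1 : (1 : ℝ) ≤ K := by exact_mod_cast hK
  -- With `z = 1 / K` a transferred cell costs `log K`, and the charge of `2 / K` per access adds up
  -- to only `2` over the `K` levels.
  have hstep : ∀ k ∈ Finset.range ν, _ := fun k hk =>
    information_transfer (i := i) (k := k) (z := 1 / K) hq P dec A hE hN hKi hi (by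
      rw [Finset.mem_range] at hk
      calc (2 * k + 2) * 2 ^ i = (k + 1) * 2 ^ (i + 1) := by ring
        _ ≤ R / 2 ^ (i + 1) * 2 ^ (i + 1) := Nat.mul_le_mul_right _ hk
        _ ≤ R := Nat.div_mul_le_self _ _) (by positivity)
      (by rw [div_le_one hK0]; exact hK1) hcorr
  have hs := Finset.sum_le_sum hstep
  rw [Finset.sum_comm, Finset.sum_const, Finset.card_range, nsmul_eq_mul, one_div (K : ℝ), Real.log_inv,
    neg_neg] at hs
  have hs2 := hs.trans (Finset.sum_le_sum (g := fun x : Fin (4 * n) → Bool =>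
      (((∑ k ∈ Finset.range ν,
          (((Finset.Ico ((2 * k + 1) * 2 ^ i) ((2 * k + 2) * 2 ^ i)).biUnion
          (A.blockCells (hardStream hq n (4 * E + 1) (extendBits x)) n (4 * E + 1))) ∩
          ((Finset.Ico (2 * k * 2 ^ i) ((2 * k + 1) * 2 ^ i)).biUnion
          (A.blockCells (hardStream hq n (4 * E + 1) (extendBits x)) n (4 * E + 1)))).card : ℕ) : ℝ) *
            Real.log K +
          (A.totalTime n (hardStream hq n (4 * E + 1) (extendBits x)) : ℝ) * (2 / K)) +
        ((∑ β ∈ Finset.range R,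
          if BalancedAt K E (extendBits x) (2 * n + β) then 0 else 1 : ℕ) : ℝ) * Real.log 16) fun x _ => by
    have h1 := (sum_dyadic_le (fun β => (A.blockCells (hardStream hq n (4 * E + 1) (extendBits x))
      n (4 * E + 1) β).card) R i).trans (A.sum_card_blockCells_le _ n (4 * E + 1))
    have h2 := sum_dyadic_le (fun β => if BalancedAt K E (extendBits x) (2 * n + β) then 0 else 1) R i
    have h1' : ((∑ k ∈ Finset.range ν,
      ∑ β ∈ Finset.Ico ((2 * k + 1) * 2 ^ i) ((2 * k + 2) * 2 ^ i),
        (A.blockCells (hardStream hq n (4 * E + 1) (extendBits x)) n (4 * E + 1) β).card : ℕ) : ℝ) *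
        (2 * (K : ℝ)⁻¹) ≤
        (A.totalTime n (hardStream hq n (4 * E + 1) (extendBits x)) : ℝ) * (2 / K) := by
      rw [← div_eq_mul_inv]
      gcongr
    have h2' : ((∑ k ∈ Finset.range ν,
      ∑ β ∈ Finset.Ico ((2 * k + 1) * 2 ^ i) ((2 * k + 2) * 2 ^ i),
        (if BalancedAt K E (extendBits x) (2 * n + β) then 0 else 1) : ℕ) : ℝ) * Real.log 16 ≤
        ((∑ β ∈ Finset.range R,
          if BalancedAt K E (extendBits x) (2 * n + β) then 0 else 1 : ℕ) : ℝ) * Real.log 16 := by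
      have : 0 ≤ Real.log 16 := Real.log_nonneg (by norm_num)
      gcongr
    refine le_trans (le_of_eq ?_) (add_le_add (add_le_add_right h1' _) h2')
    push_cast
    rw [Finset.sum_mul, Finset.sum_mul, Finset.sum_mul, ← Finset.sum_add_distrib,
      ← Finset.sum_add_distrib])
  rw [Finset.sum_add_distrib, ← Finset.sum_mul] at hs2
  have hl2 := Real.log_two_gt_d9
  have hl2' := Real.log_two_lt_d9
  have h16 : Real.log 16 = 4 * Real.log 2 := by
    rw [show (16 : ℝ) = 2 ^ 4 by norm_num, Real.log_pow]; norm_num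
  have hm : (2 : ℝ) ^ K ≤ 2 ^ i := pow_le_pow_right₀ (by norm_num) hKi
  -- One factor `2` is lost because only the first halves count, another by rounding to whole
  -- intervals.
  have hRν : (R : ℝ) ≤ 4 * (ν * 2 ^ i) := by
    have h2i : 2 ^ (i + 1) ≤ R := (Nat.pow_le_pow_right (by norm_num) (by omega)).trans hN
    have h1 : 1 ≤ ν := by rw [hν, Nat.le_div_iff_mul_le (by positivity)]; omega
    have h2 := Nat.lt_div_mul_add (a := R) (b := 2 ^ (i + 1)) (by positivity)
    have h3 : R ≤ 4 * (ν * 2 ^ i) := by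
      have h4 : 2 ^ i ≤ ν * 2 ^ i := Nat.le_mul_of_pos_left _ h1
      have h5 : R / 2 ^ (i + 1) * 2 ^ (i + 1) = 2 * (ν * 2 ^ i) := by rw [← hν, pow_succ]; ring
      rw [h5, pow_succ] at h2
      omega
    exact_mod_cast h3
  have hleft : 2 ^ (4 * n) * ((R : ℝ) * (11 / 100)) ≤
      ν * (2 ^ (4 * n) * (2 ^ i * (Real.log 2 - 1 / 8) - Real.log (n + 1))) := by
    -- Here `44 / 100 < log 2 - 1 / 8 - 1 / 8`, the second `1 / 8` paying for the value at the
    -- midpoint.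
    have h1 : (2 : ℝ) ^ i * (44 / 100) ≤ 2 ^ i * (Real.log 2 - 1 / 8) - Real.log (n + 1) := by
      nlinarith [show (0 : ℝ) < 2 ^ i by positivity]
    calc (2 : ℝ) ^ (4 * n) * ((R : ℝ) * (11 / 100)) ≤
        2 ^ (4 * n) * (ν * (2 ^ i * (44 / 100))) := by
          refine mul_le_mul_of_nonneg_left ?_ (by positivity)
          linarith
      _ = ν * (2 ^ (4 * n) * (2 ^ i * (44 / 100))) := by ring
      _ ≤ _ := by gcongr
  have hright := mul_le_mul_of_nonneg_right hbad' (show 0 ≤ Real.log 16 by rw [h16]; linarith)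
  have h3 : (2 : ℝ) ^ (4 * n) * ((R : ℝ) / 100) * Real.log 16 ≤
      2 ^ (4 * n) * ((R : ℝ) * (3 / 100)) := by
    rw [h16]
    have : (0 : ℝ) ≤ 2 ^ (4 * n) * R := by positivity
    nlinarith
  linarith

/-- Every one of the `K` levels needs its own share of information, but all levels together transfer
no more cells than there are accesses. -/
theorem sum_totalTime_ge (hE : 1 ≤ E) (hK : 0 < K) (hN : 2 ^ (2 * K) ≤ n / (4 * E + 1))
    (hbad : ((K : ℝ) + 1) * (2 * K + 1) * (2 * Real.exp (-(E ^ 2 / (2 * K)))) ≤ 1 / 100)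
    (hlog : Real.log (n + 1) ≤ 2 ^ K / 8)
    (hcorr : ∀ x : Fin (4 * n) → Bool, A.CorrectOn P dec (hardPattern hq K (4 * E + 1) n)
      (hardStream hq n (4 * E + 1) (extendBits x))) :
    2 ^ (4 * n) * (K * (n / (4 * E + 1) : ℕ) * (2 / 25)) ≤
      (∑ x : Fin (4 * n) → Bool,
        (A.totalTime n (hardStream hq n (4 * E + 1) (extendBits x)) : ℝ)) * (Real.log K + 2) := by
  have hK0 : (0 : ℝ) < K := by exact_mod_cast hK
  have h1 := Finset.sum_le_sum fun i (hi : i ∈ Finset.Ico K (2 * K)) =>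
    level_bound hq P dec A hE hK hN hbad hlog (Finset.mem_Ico.1 hi).1 (Finset.mem_Ico.1 hi).2 hcorr
  rw [Finset.sum_comm, Finset.sum_const, Nat.card_Ico, nsmul_eq_mul,
    show 2 * K - K = K by omega] at h1
  rw [Finset.sum_mul]
  refine le_trans (le_of_eq (by ring)) (h1.trans (Finset.sum_le_sum fun x _ => ?_))
  rw [Finset.sum_add_distrib, ← Finset.sum_mul, Finset.sum_const, Nat.card_Ico, nsmul_eq_mul,
    show 2 * K - K = K by omega, mul_add]
  have h3 := (sum_card_inter_dyadic_le (A.blockCells (hardStream hq n (4 * E + 1) (extendBits x))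
    n (4 * E + 1)) (n / (4 * E + 1)) (Finset.Ico K (2 * K))).trans
      (A.sum_card_blockCells_le _ n (4 * E + 1))
  have h4 : 0 ≤ Real.log K := Real.log_nonneg (by exact_mod_cast hK)
  refine add_le_add ?_ (le_of_eq (by field_simp))
  rw [← Nat.cast_sum]
  gcongr

end Average

/-! ### From average-case to randomised time -/

/-- The lower bound on the average time of deterministic algorithms carries over to the expected time
of randomised ones on some hard stream. -/
theorem exists_le_expectedAmortisedTime {n q K E : ℕ} {O Ω : Type*} [MeasurableSpace Ω]
    (hq : 4 ≤ q) (P : StreamProblem) (dec : ℕ → O → ℕ) (μ : Measure Ω) [IsProbabilityMeasure μ]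
    (A : Ω → CellProbeAlgorithm 1 q O) (hE : 1 ≤ E) (hK : 0 < K)
    (hN : 2 ^ (2 * K) ≤ n / (4 * E + 1))
    (hbad : ((K : ℝ) + 1) * (2 * K + 1) * (2 * Real.exp (-(E ^ 2 / (2 * K)))) ≤ 1 / 100)
    (hlog : Real.log (n + 1) ≤ 2 ^ K / 8)
    (hA : Solves μ A P dec (hardPattern hq K (4 * E + 1) n)) (b : ℝ)
    (hb : n * b * (Real.log K + 2) ≤ K * (n / (4 * E + 1) : ℕ) * (2 / 25)) :
    ∃ S : ℕ → Fin q, ENNReal.ofReal b ≤ expectedAmortisedTime μ A n S := by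
  by_contra! hcon
  set St : (Fin (4 * n) → Bool) → ℕ → Fin q := fun x =>
    hardStream hq n (4 * E + 1) (extendBits x) with hSt
  have hn0 : 0 < n := by
    have : 0 < 2 ^ (2 * K) := by positivity
    have : n / (4 * E + 1) ≤ n := Nat.div_le_self _ _
    omega
  have hlogK : 0 ≤ Real.log K := Real.log_nonneg (by exact_mod_cast hK)
  -- There are finitely many hard streams, so almost every deterministic choice is correct on all of
  -- them at once.
  have hae : ∀ᵐ ω ∂μ, ENNReal.ofReal (2 ^ (4 * n) * (n * b)) ≤
      ∑ x : Fin (4 * n) → Bool, ((A ω).totalTime n (St x) : ℝ≥0∞) := by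
    have hall : ∀ᵐ ω ∂μ, ∀ x, (A ω).CorrectOn P dec (hardPattern hq K (4 * E + 1) n) (St x) :=
      ae_all_iff.2 fun x => hA.correct _
    filter_upwards [hall] with ω hω
    have h1 := sum_totalTime_ge hq P dec (A ω) hE hK hN hbad hlog hω
    have h2 : 2 ^ (4 * n) * (n * b) ≤ ∑ x, ((A ω).totalTime n (St x) : ℝ) := by
      refine le_of_mul_le_mul_right (le_trans ?_ h1) (show 0 < Real.log K + 2 by linarith)
      rw [mul_assoc]
      gcongr
    refine (ENNReal.ofReal_le_ofReal h2).trans (le_of_eq ?_)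
    rw [← Nat.cast_sum, ENNReal.ofReal_natCast, Nat.cast_sum]
  have h1 := lintegral_mono_ae hae
  have hmeas : ∀ x ∈ Finset.univ, AEMeasurable
      (fun ω => ((A ω).totalTime n (St x) : ℝ≥0∞)) μ := fun x _ =>
    (measurable_from_top (f := fun m : ℕ => (m : ℝ≥0∞))).comp_aemeasurable
      (hA.aemeasurable_time (St x))
  rw [lintegral_const, measure_univ, mul_one, lintegral_finsetSum' _ hmeas] at h1
  have hn' : (n : ℝ≥0∞) ≠ 0 := by exact_mod_cast hn0.ne'
  have h2 : ∑ x : Fin (4 * n) → Bool, ∫⁻ ω, ((A ω).totalTime n (St x) : ℝ≥0∞) ∂μ <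
      ∑ _x : Fin (4 * n) → Bool, ENNReal.ofReal b * n := by
    refine ENNReal.sum_lt_sum_of_nonempty Finset.univ_nonempty fun x _ => ?_
    have := hcon (St x)
    rw [expectedAmortisedTime] at this
    exact (ENNReal.div_lt_iff (.inl hn') (.inl (ENNReal.natCast_ne_top n))).1 this
  refine absurd (h1.trans_lt h2) (not_lt.2 (le_of_eq ?_))
  rw [Finset.sum_const, Finset.card_univ, nsmul_eq_mul, Fintype.card_fun, Fintype.card_bool,
    Fintype.card_fin, ENNReal.ofReal_mul (by positivity), ENNReal.ofReal_mul (by positivity),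
    ENNReal.ofReal_natCast, mul_comm (ENNReal.ofReal b)]
  congr 1
  rw [ENNReal.ofReal_pow (by norm_num)]
  push_cast
  norm_num

/-! ### Choice of parameters -/

theorem eight_mul_log_le {K : ℕ} (hK : 100 ≤ K) : 8 * Real.log K ≤ K := by
  have hK' : (100 : ℝ) ≤ K := by exact_mod_cast hK
  have h1 := Real.log_le_sub_one_of_pos (show (0 : ℝ) < K / 64 by positivity)
  rw [Real.log_div (by positivity) (by norm_num), show (64 : ℝ) = 2 ^ 6 by norm_num,
    Real.log_pow] at h1
  have := Real.log_two_lt_d9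
  push_cast at h1
  linarith

theorem two_le_log {K : ℕ} (hK : 100 ≤ K) : 2 ≤ Real.log K := by
  have hK' : (64 : ℝ) ≤ K := by exact_mod_cast (show 64 ≤ K by omega)
  have h1 := Real.log_le_log (by norm_num) hK'
  rw [show (64 : ℝ) = 2 ^ 6 by norm_num, Real.log_pow] at h1
  have := Real.log_two_gt_d9
  push_cast at h1
  linarith

theorem mul_add_le_two_pow {K : ℕ} (hK : 100 ≤ K) : 32 * K + 32 ≤ 2 ^ K := by
  induction K, hK using Nat.le_induction with
  | base => norm_num
  | succ K hK ih => rw [pow_succ]; omega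

/-- The bound on deviations of sums of `K` signs. -/
noncomputable def deviation (K : ℕ) : ℕ := ⌈√(8 * K * Real.log K)⌉₊

theorem forty_le_sqrt {K : ℕ} (hK : 100 ≤ K) : 40 ≤ √(8 * K * Real.log K) := by
  have hK' : (100 : ℝ) ≤ K := by exact_mod_cast hK
  apply Real.le_sqrt_of_sq_le
  nlinarith [two_le_log hK]

theorem deviation_le {K : ℕ} (hK : 100 ≤ K) : deviation K ≤ K := by
  refine Nat.ceil_le.2 (Real.sqrt_le_iff.2 ⟨by positivity, ?_⟩)
  nlinarith [eight_mul_log_le hK, show (0 : ℝ) ≤ K by positivity]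

theorem one_le_deviation {K : ℕ} (hK : 100 ≤ K) : 1 ≤ deviation K := by
  rw [Nat.one_le_iff_ne_zero, ← Nat.pos_iff_ne_zero]
  exact Nat.ceil_pos.2 (by linarith [forty_le_sqrt hK])

/-- As `8 * K * log K ≤ E ^ 2` for `E = deviation K`, each event has probability at most `2 / K ^
4`, against order `K ^ 2` events. -/
theorem union_bound_le {K : ℕ} (hK : 100 ≤ K) :
    ((K : ℝ) + 1) * (2 * K + 1) * (2 * Real.exp (-((deviation K : ℝ) ^ 2 / (2 * K)))) ≤ 1 / 100 := by
  have hK' : (100 : ℝ) ≤ K := by exact_mod_cast hK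
  have hl := two_le_log hK
  have h1 : 8 * K * Real.log K ≤ (deviation K : ℝ) ^ 2 :=
    (Real.sqrt_le_left (by positivity)).1 (Nat.le_ceil _)
  have h2 : Real.exp (-((deviation K : ℝ) ^ 2 / (2 * K))) ≤ 1 / (K : ℝ) ^ 4 := by
    have e : (1 : ℝ) / (K : ℝ) ^ 4 = Real.exp (-(4 * Real.log K)) := by
      rw [Real.exp_neg, mul_comm, Real.exp_mul, Real.exp_log (by positivity), one_div]
      norm_cast
    rw [e, Real.exp_le_exp, neg_le_neg_iff, le_div_iff₀ (by positivity)]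
    linarith
  calc _ ≤ ((K : ℝ) + 1) * (2 * K + 1) * (2 * (1 / (K : ℝ) ^ 4)) := by gcongr
    _ ≤ (2 * K) * (3 * K) * (2 * (1 / (K : ℝ) ^ 4)) := by
      gcongr <;> linarith
    _ = 12 / (K : ℝ) ^ 2 := by field_simp; norm_num
    _ ≤ 1 / 100 := by
      rw [div_le_div_iff₀ (by positivity) (by norm_num)]
      nlinarith

theorem two_pow_le_div {K n : ℕ} (hK : 100 ≤ K) (hn : 2 ^ (4 * K) ≤ n) :
    2 ^ (2 * K) ≤ n / (4 * deviation K + 1) := by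
  rw [Nat.le_div_iff_mul_le (by omega)]
  refine le_trans ?_ hn
  rw [show 4 * K = 2 * K + 2 * K by ring, pow_add 2 (2 * K)]
  refine Nat.mul_le_mul_left _ ?_
  have h1 := deviation_le hK
  have h2 := mul_add_le_two_pow hK
  have h3 : 2 ^ K ≤ 2 ^ (2 * K) := Nat.pow_le_pow_right (by norm_num) (by omega)
  omega

/-- This is why the levels start at `K`: even the shortest half carries far more bits than the value
at the midpoint. -/
theorem log_succ_le {K n : ℕ} (hK : 100 ≤ K) (hn : n < 2 ^ (4 * K + 4)) :
    Real.log (n + 1) ≤ 2 ^ K / 8 := by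
  have h1 : (n : ℝ) + 1 ≤ 2 ^ (4 * K + 4) := by exact_mod_cast hn
  have h2 := Real.log_le_log (by positivity) h1
  rw [Real.log_pow] at h2
  have h3 : ((32 * K + 32 : ℕ) : ℝ) ≤ 2 ^ K := by exact_mod_cast mul_add_le_two_pow hK
  have := Real.log_two_lt_d9
  push_cast at h2 h3
  nlinarith

/-- The block length is at most `15 * √(K log K)`, rounding `n / r` costs a factor `2`, `√(log₂ n) ≤
3 * √K`, and `log K + 2 ≤ 2 * log K`. Together `2 * 15 * 3 * 2 / 3000 = 6 / 100`, below `2 / 25`. -/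
theorem rate_bound {K n : ℕ} (hK : 100 ≤ K) (hn : 2 ^ (4 * K) ≤ n) (hn' : n < 2 ^ (4 * K + 4)) :
    n * (1 / 3000 * (√(Real.logb 2 n) / (Real.logb 2 (Real.logb 2 n)) ^ (3 / 2 : ℝ))) *
      (Real.log K + 2) ≤ K * (n / (4 * deviation K + 1) : ℕ) * (2 / 25) := by
  have hK' : (100 : ℝ) ≤ K := by exact_mod_cast hK
  have hn0 : (0 : ℝ) < n := by
    have : 0 < 2 ^ (4 * K) := by positivity
    exact_mod_cast this.trans_le hn
  have hl := two_le_log hK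
  have hlg1 : Real.logb 2 n ≤ 8 * K := by
    rw [Real.logb_le_iff_le_rpow (by norm_num) hn0]
    have h1 : (n : ℝ) ≤ 2 ^ (8 * K) := by
      have : n ≤ 2 ^ (8 * K) := hn'.le.trans (Nat.pow_le_pow_right (by norm_num) (by omega))
      exact_mod_cast this
    exact_mod_cast h1
  have hlg2 : (K : ℝ) ≤ Real.logb 2 n := by
    rw [Real.le_logb_iff_rpow_le (by norm_num) hn0]
    have h1 : (2 : ℝ) ^ K ≤ n := by
      have : 2 ^ K ≤ n := (Nat.pow_le_pow_right (by norm_num) (by omega)).trans hn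
      exact_mod_cast this
    exact_mod_cast h1
  set lg := Real.logb 2 n
  have hll : Real.log K ≤ Real.logb 2 lg := by
    have h1 := Real.log_le_log (by positivity) hlg2
    rw [Real.logb]
    have h2 := Real.log_two_lt_d9
    have h3 := Real.log_two_gt_d9
    rw [le_div_iff₀ (by linarith)]
    nlinarith
  set a := √(K : ℝ) with ha
  set b := √(Real.log K) with hb
  have ha2 : a ^ 2 = K := Real.sq_sqrt (by positivity)
  have hb2 : b ^ 2 = Real.log K := Real.sq_sqrt (by linarith)
  have ha0 : 0 < a := Real.sqrt_pos.2 (by linarith)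
  have hb0 : 0 < b := Real.sqrt_pos.2 (by linarith)
  have hnum : √lg ≤ 3 * a := by
    refine Real.sqrt_le_iff.2 ⟨by positivity, ?_⟩
    rw [mul_pow, ha2]; linarith
  have hden : b ^ 3 ≤ (Real.logb 2 lg) ^ (3 / 2 : ℝ) := by
    have h1 : b ^ 3 = (Real.log K) ^ (3 / 2 : ℝ) := by
      rw [hb, Real.sqrt_eq_rpow, ← Real.rpow_natCast, ← Real.rpow_mul (by linarith)]
      norm_num
    rw [h1]
    exact Real.rpow_le_rpow (by linarith) hll (by norm_num)
  have hrate : √lg / (Real.logb 2 lg) ^ (3 / 2 : ℝ) ≤ 3 * a / b ^ 3 := by gcongr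
  have hr : ((4 * deviation K + 1 : ℕ) : ℝ) ≤ 15 * (a * b) := by
    have h1 := Nat.ceil_lt_add_one (Real.sqrt_nonneg (8 * K * Real.log K))
    have h2 := forty_le_sqrt hK
    have h3 : √(8 * K * Real.log K) ≤ 3 * (a * b) := by
      refine Real.sqrt_le_iff.2 ⟨by positivity, ?_⟩
      rw [mul_pow, mul_pow, ha2, hb2]
      nlinarith
    change ((deviation K : ℕ) : ℝ) < _ at h1
    push_cast
    linarith
  have hR : (n : ℝ) ≤ 2 * ((n / (4 * deviation K + 1) : ℕ) * (15 * (a * b))) := by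
    have h1 := Nat.lt_div_mul_add (a := n) (b := 4 * deviation K + 1) (by omega)
    have h2 : 1 ≤ n / (4 * deviation K + 1) := by
      have := two_pow_le_div hK hn
      have : 0 < 2 ^ (2 * K) := by positivity
      omega
    have h3 : n ≤ 2 * (n / (4 * deviation K + 1) * (4 * deviation K + 1)) := by
      have := Nat.mul_le_mul_right (4 * deviation K + 1) h2
      omega
    have h4 : (n : ℝ) ≤ 2 * ((n / (4 * deviation K + 1) : ℕ) * (4 * deviation K + 1 : ℕ)) := by
      exact_mod_cast h3
    refine h4.trans ?_
    gcongr
  set R : ℝ := ((n / (4 * deviation K + 1) : ℕ) : ℝ)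
  have hR0 : 0 ≤ R := Nat.cast_nonneg _
  have hrate0 : 0 ≤ 1 / 3000 * (√lg / (Real.logb 2 lg) ^ (3 / 2 : ℝ)) :=
    mul_nonneg (by norm_num) (div_nonneg (Real.sqrt_nonneg _) (Real.rpow_nonneg (by linarith) _))
  calc _ ≤ 2 * (R * (15 * (a * b))) * (1 / 3000 * (3 * a / b ^ 3)) * (2 * Real.log K) := by
        gcongr
        linarith
    _ = a ^ 2 * R * (6 / 100) := by
        rw [← hb2]; field_simp; ring
    _ ≤ K * R * (2 / 25) := by
        rw [ha2]
        exact mul_le_mul_of_nonneg_left (by norm_num) (by positivity)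

theorem theorem2 :
    ∃ c : ℝ, 0 < c ∧ ∃ n₀ : ℕ, ∀ n : ℕ, n₀ ≤ n → ∀ q : ℕ, 4 ≤ q → ∀ P : StreamProblem,
      ∃ F : Fin n → Fin q,
        ∀ (O : Type*) (dec : ℕ → O → ℕ) (Ω : Type*) [MeasurableSpace Ω] (μ : Measure Ω)
          [IsProbabilityMeasure μ] (A : Ω → CellProbeAlgorithm 1 q O),
          Solves μ A P dec F →
            ∃ S : ℕ → Fin q,
              ENNReal.ofReal
                  (c * (√(Real.logb 2 n) / (Real.logb 2 (Real.logb 2 n)) ^ (3 / 2 : ℝ))) ≤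
                expectedAmortisedTime μ A n S := by
  refine ⟨1 / 3000, by norm_num, 2 ^ 400, fun n hn q hq P => ?_⟩
  have hlog : 400 ≤ Nat.log 2 n := Nat.le_log_of_pow_le (by norm_num) hn
  have hn0 : n ≠ 0 := by
    rintro rfl
    simp at hlog
  -- A quarter of the logarithm leaves room for special blocks up to distance `2 ^ (2 * K)` times
  -- the block length; `n ≥ 2 ^ 400` gives `K ≥ 100`.
  set K := Nat.log 2 n / 4
  have hK : 100 ≤ K := by omega
  have h1 : 2 ^ (4 * K) ≤ n := Nat.pow_le_of_le_log hn0 (by omega)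
  have h2 : n < 2 ^ (4 * K + 4) := Nat.lt_pow_of_log_lt (by norm_num) (by omega)
  refine ⟨hardPattern hq K (4 * deviation K + 1) n, fun O dec Ω _ μ _ A hA => ?_⟩
  exact exists_le_expectedAmortisedTime hq P dec μ A (one_le_deviation hK) (by omega)
    (two_pow_le_div hK h1) (union_bound_le hK) (log_succ_le hK h2) hA _ (rate_bound hK h1 h2)
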